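/- A probability distribution $p$ on $[n]=\{1,\dots,n\}$ is \emph{$T$-big} if $p(i)\ge T$ for all $i\in[n]$, and \emph{$\varepsilon$-far from $T$-big} if $d_{TV}(p,q)=\frac12\sum_{i}|p(i)-q(i)|\ge\varepsilon$ for every $T$-big distribution $q$ on $[n]$. An algorithm that takes $m$ samples receives $m$ independent samples from an unknown distribution $p$ on $[n]$ and, possibly using internal randomness, outputs accept or reject. It is a \emph{$(T,\varepsilon)$-bigness tester} on $[n]$ if it accepts with probability at least $2/3$ whenever $p$ is $T$-big, and rejects with probability at least $2/3$ whenever $p$ is $\varepsilon$-far from $T$-big. There exist constants $\varepsilon_0>0$, $c>0$ and a function $\beta$ assigning to every $\varepsilon\in(0,\varepsilon_0]$ a number $\beta(\varepsilon)>0$ such that the following hold. (1) For every $a>0$ there is $n_0$ such that for all $n\ge n_0$ and all $\varepsilon$ with $a/n\le\varepsilon\le\varepsilon_0$, every $(1/(\beta(\varepsilon)n),\varepsilon)$-bigness tester on $[n]$ takes at least $$c\,\frac{n\log^2(1/\varepsilon)}{\log n}$$ samples. (2) In particular, for every constant $\varepsilon\in(0,\varepsilon_0]$ (for which $\beta=\beta(\varepsilon)$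 is a constant, independent of $n$), there are $c'>0$ and $n_1$ such that for all $n\ge n_1$ every $(1/(\beta n),\varepsilon)$-bigness tester on $[n]$ takes at least $c'\,n/\log n$ samples. -/

import Mathlib

namespace Bigness

/-- `p` is a probability distribution on the `n`-element domain with `p i ≥ T` for every `i`. -/
def IsBig {n : ℕ} (T : ℝ) (p : Fin n → ℝ) : Prop :=
  p ∈ stdSimplex ℝ (Fin n) ∧ ∀ i, T ≤ p i

/-- Total variation distance of two distributions on `Fin n`. -/
noncomputable def tvDist {n : ℕ} (p q : Fin n → ℝ) : ℝ :=
  (1 / 2) * ∑ i, |p i - q i|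

/-- `p` is a probability distribution that has total variation distance at least `ε` from every
`T`-big distribution. -/
def IsFarFromBig {n : ℕ} (T ε : ℝ) (p : Fin n → ℝ) : Prop :=
  p ∈ stdSimplex ℝ (Fin n) ∧ ∀ q : Fin n → ℝ, IsBig T q → ε ≤ tvDist p q

/-- A randomized algorithm that receives `m` samples from the domain `Fin n` and then
outputs accept (`true`) or reject (`false`); its internal randomness is arbitrary. -/
abbrev Algorithm (n m : ℕ) : Type := (Fin m → Fin n) → PMF Bool

/-- The probability, over `m` independent samples from `p` and the internal randomness, that the
algorithm `A` outputs `b`. -/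
noncomputable def outputProb {n m : ℕ} (A : Algorithm n m) (p : Fin n → ℝ) (b : Bool) : ℝ :=
  ∑ x : Fin m → Fin n, (∏ j, p (x j)) * (A x b).toReal

/-- `A` distinguishes `T`-big distributions from those that are `ε`-far from `T`-big, with
probability at least `2/3`. -/
def IsTester {n m : ℕ} (A : Algorithm n m) (T ε : ℝ) : Prop :=
  (∀ p : Fin n → ℝ, IsBig T p → 2 / 3 ≤ outputProb A p true) ∧
  (∀ p : Fin n → ℝ, IsFarFromBig T ε p → 2 / 3 ≤ outputProb A p false)

end Bigness

open Finset

namespace Bigness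

/-! The argument is the two-prior method with moment matching. Take intensities `x j`, one of them
zero and the others at least 1, and two laws `P`, `Q` on them with the same moments of every order
below `J = N + 2`. `P` gives the zero no mass, and `Q` gives it at least `exp (-10 D) / 100`. Draw
`n` coordinates independently and normalise. Under `P` every entry is at least `1 / sum`, and the
sum rarely exceeds `40 n` because the mean is at most 2, so the result is usually `1 / (40 n)`-big.
Under `Q` there are usually at least `n * Q z / 4` zeros, each short of the threshold by `1 / (40
n)`, so the result is usually at distance at least `Q z / 160` from big.

A tester cannot separate the two. Run it on the first `m` of a Poisson number of samples, with
intensities `y = lam * x`. In each coordinate separately the acceptance weight is then a Poisson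
mixture `∑ g k * exp (-t) * t ^ k / k!` with `g k` in `[0, 1]` (`poissonized_update`). If `y ≤ J /
20`, this is a polynomial of degree below `J` up to an error of order `exp (-J)`, so exchanging `P`
for `Q` in one coordinate costs at most `4 exp (-J)`. Exchanging all `n` coordinates in turn
(`abs_iidExp_sub_le`) costs at most `4 n exp (-J)`, which is small once `N` is about `2 log n`.

The laws are explicit: they are the positive and negative parts of a divided difference on the nodes
`0`, `D² + 1/4` and `D² + i²` for `i ≤ N`, rescaled by `D²`. Such a functional kills low degrees.
Its weight at 0 is compared with its total first absolute moment through factorial identities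
(`abs_nodeWeight_zero_ge`, `sum_abs_nodeWeight_mul_node_le`).

The largest intensity is at most `1 + N² / D²`, so `lam` can be of order `D² / N`, and up to order
`lam * n` samples are useless. With `D` of order `log (1/ε)` and `N` of order `log n` this is the
claimed bound, with `β` constantly 40. -/

/-- Expectation of `Φ` over `n` independent coordinates, each with law `P`. -/
noncomputable def iidExp {ι : Type*} [Fintype ι] {n : ℕ} (P : ι → ℝ) (Φ : (Fin n → ι) → ℝ) : ℝ :=
  ∑ v : Fin n → ι, (∏ i, P (v i)) * Φ v

/-! ### Independent coordinates and the hybrid argument -/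

section iidExp

variable {ι : Type*} [Fintype ι] {n : ℕ}

lemma iidExp_succ (P : ι → ℝ) (Φ : (Fin (n + 1) → ι) → ℝ) :
    iidExp P Φ = ∑ j, P j * iidExp P (fun v => Φ (Fin.cons j v)) := by
  unfold iidExp
  rw [← (Fin.consEquiv (fun _ : Fin (n + 1) => ι)).sum_comp, Fintype.sum_prod_type]
  refine Finset.sum_congr rfl fun j _ => ?_
  rw [Finset.mul_sum]
  refine Finset.sum_congr rfl fun v _ => ?_
  simp [Fin.consEquiv, Fin.prod_univ_succ, mul_assoc]

lemma iidExp_prod (P : ι → ℝ) (f : Fin n → ι → ℝ) :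
    iidExp P (fun v => ∏ i, f i (v i)) = ∏ i, ∑ j, P j * f i j := by
  classical
  unfold iidExp
  rw [Fintype.prod_sum]
  exact Finset.sum_congr rfl fun v _ => by rw [Finset.prod_mul_distrib]

lemma iidExp_one (P : ι → ℝ) (hP : ∑ j, P j = 1) :
    iidExp P (fun _ : Fin n → ι => (1 : ℝ)) = 1 := by
  have := iidExp_prod (n := n) P (fun _ _ => 1)
  simpa [hP] using this

lemma iidExp_mono {P : ι → ℝ} (hP : ∀ j, 0 ≤ P j) {Φ Ψ : (Fin n → ι) → ℝ}
    (h : ∀ v, (∀ i, P (v i) ≠ 0) → Φ v ≤ Ψ v) : iidExp P Φ ≤ iidExp P Ψ := by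
  refine Finset.sum_le_sum fun v _ => ?_
  by_cases hv : ∀ i, P (v i) ≠ 0
  · exact mul_le_mul_of_nonneg_left (h v hv) (Finset.prod_nonneg fun i _ => hP _)
  · push Not at hv
    obtain ⟨i, hi⟩ := hv
    rw [Finset.prod_eq_zero (Finset.mem_univ i) hi]
    simp

lemma iidExp_add (P : ι → ℝ) (Φ Ψ : (Fin n → ι) → ℝ) :
    iidExp P (fun v => Φ v + Ψ v) = iidExp P Φ + iidExp P Ψ := by
  simp [iidExp, mul_add, Finset.sum_add_distrib]

lemma iidExp_const_mul (P : ι → ℝ) (c : ℝ) (Φ : (Fin n → ι) → ℝ) :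
    iidExp P (fun v => c * Φ v) = c * iidExp P Φ := by
  simp only [iidExp, Finset.mul_sum]
  exact Finset.sum_congr rfl fun v _ => by ring

lemma iidExp_sum_coord (P : ι → ℝ) (hP : ∑ j, P j = 1) (f : ι → ℝ) :
    iidExp P (fun v : Fin n → ι => ∑ i, f (v i)) = n * ∑ j, P j * f j := by
  classical
  have key : ∀ i : Fin n, iidExp P (fun v : Fin n → ι => f (v i)) = ∑ j, P j * f j := by
    intro i
    have := iidExp_prod P (fun (k : Fin n) j => if k = i then f j else 1)
    have h1 : (fun v : Fin n → ι => ∏ k, if k = i then f (v k) else 1) = fun v => f (v i) := by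
      funext v
      simp [Finset.prod_ite_eq']
    rw [h1] at this
    rw [this, Finset.prod_eq_single i]
    · simp
    · intro k _ hk
      simp [hk, hP]
    · simp
  have : iidExp P (fun v : Fin n → ι => ∑ i, f (v i)) =
      ∑ i : Fin n, iidExp P (fun v : Fin n → ι => f (v i)) := by
    simp only [iidExp, Finset.mul_sum]
    exact Finset.sum_comm
  rw [this]
  simp [key]

/-- Replacing the coordinate law one coordinate at a time. -/
lemma abs_iidExp_sub_le {P Q : ι → ℝ} (hP : ∀ j, 0 ≤ P j) (hP1 : ∑ j, P j = 1)
    (hQ : ∀ j, 0 ≤ Q j) (hQ1 : ∑ j, Q j = 1) {η : ℝ} {Φ : (Fin n → ι) → ℝ}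
    (h : ∀ (i : Fin n) (v : Fin n → ι),
      |∑ j, (P j - Q j) * Φ (Function.update v i j)| ≤ η) :
    |iidExp P Φ - iidExp Q Φ| ≤ n * η := by
  induction n with
  | zero => simp [iidExp]
  | succ n ih =>
    -- Exchange the law of the first coordinate while the others follow `P`; then, with the first
    -- drawn from `Q`, the remaining difference is handled by induction.
    have e : iidExp P Φ - iidExp Q Φ =
        iidExp P (fun v => ∑ j, (P j - Q j) * Φ (Fin.cons j v)) +
        ∑ j, Q j * (iidExp P (fun v => Φ (Fin.cons j v)) -
          iidExp Q (fun v => Φ (Fin.cons j v))) := by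
      have e1 : iidExp P (fun v => ∑ j, (P j - Q j) * Φ (Fin.cons j v)) =
          ∑ j, (P j - Q j) * iidExp P (fun v => Φ (Fin.cons j v)) := by
        simp only [iidExp, Finset.mul_sum]
        rw [Finset.sum_comm]
        exact Finset.sum_congr rfl fun j _ => Finset.sum_congr rfl fun v _ => by ring
      rw [iidExp_succ, iidExp_succ, e1, ← Finset.sum_sub_distrib, ← Finset.sum_add_distrib]
      exact Finset.sum_congr rfl fun j _ => by ring
    have b1 : |iidExp P (fun v => ∑ j, (P j - Q j) * Φ (Fin.cons j v))| ≤ η := by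
      have hv : ∀ v : Fin n → ι, |∑ j, (P j - Q j) * Φ (Fin.cons j v)| ≤ η := by
        intro v
        by_cases hι : Nonempty ι
        · obtain ⟨j₀⟩ := hι
          have := h 0 (Fin.cons j₀ v)
          simpa using this
        · exact absurd hP1 (by simp [not_nonempty_iff.mp hι])
      refine (Finset.abs_sum_le_sum_abs _ _).trans ?_
      calc ∑ v : Fin n → ι, |(∏ i, P (v i)) * ∑ j, (P j - Q j) * Φ (Fin.cons j v)|
          ≤ iidExp P (fun _ : Fin n → ι => η * 1) := by
            refine Finset.sum_le_sum fun v _ => ?_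
            have h0 : 0 ≤ ∏ i, P (v i) := Finset.prod_nonneg fun i _ => hP _
            rw [abs_mul, abs_of_nonneg h0, mul_one]
            exact mul_le_mul_of_nonneg_left (hv v) h0
        _ = η := by rw [iidExp_const_mul, iidExp_one P hP1, mul_one]
    have b2 : |∑ j, Q j * (iidExp P (fun v => Φ (Fin.cons j v)) -
          iidExp Q (fun v => Φ (Fin.cons j v)))| ≤ n * η := by
      refine (Finset.abs_sum_le_sum_abs _ _).trans ?_
      calc _ ≤ ∑ j, Q j * (n * η) := by
            refine Finset.sum_le_sum fun j _ => ?_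
            rw [abs_mul, abs_of_nonneg (hQ j)]
            refine mul_le_mul_of_nonneg_left (ih fun i v => ?_) (hQ j)
            simpa [Fin.cons_update] using h i.succ (Fin.cons j v)
        _ = n * η := by rw [← Finset.sum_mul, hQ1, one_mul]
    rw [e]
    refine (abs_add_le _ _).trans ?_
    push_cast
    linarith

end iidExp

/-! ### The Poissonized acceptance weight as a function of one intensity -/

/-- The Poissonized acceptance weight: with unnormalized intensities `u`, the mass of the event
that the number of samples `M` lies in `[m, R)`, weighted by `a` on the first `m` samples. -/
noncomputable def poissonized {n m : ℕ} (a : (Fin m → Fin n) → ℝ) (R : ℕ) (u : Fin n → ℝ) : ℝ :=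
  Real.exp (-∑ i, u i) *
    ∑ M ∈ Ico m R, (∑ i, u i) ^ (M - m) / (M.factorial : ℝ) * ∑ x, (∏ j, u (x j)) * a x

section Coordinate

open Polynomial

/-- Coefficientwise domination `0 ≤ p ≤ q`. -/
def CoeffLE (p q : ℝ[X]) : Prop := ∀ k, 0 ≤ p.coeff k ∧ p.coeff k ≤ q.coeff k

lemma CoeffLE.mul {p q p' q' : ℝ[X]} (h : CoeffLE p q) (h' : CoeffLE p' q') :
    CoeffLE (p * p') (q * q') := by
  intro k
  rw [coeff_mul, coeff_mul]
  refine ⟨Finset.sum_nonneg fun x _ => mul_nonneg (h _).1 (h' _).1,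
    Finset.sum_le_sum fun x _ => mul_le_mul (h _).2 (h' _).2 (h' _).1 ((h _).1.trans (h _).2)⟩

lemma CoeffLE.sum {α : Type*} (s : Finset α) {p q : α → ℝ[X]} (h : ∀ x ∈ s, CoeffLE (p x) (q x)) :
    CoeffLE (∑ x ∈ s, p x) (∑ x ∈ s, q x) := by
  intro k
  rw [finsetSum_coeff, finsetSum_coeff]
  exact ⟨Finset.sum_nonneg fun x hx => (h x hx k).1, Finset.sum_le_sum fun x hx => (h x hx k).2⟩

lemma coeffLE_refl_iff {p : ℝ[X]} : CoeffLE p p ↔ ∀ k, 0 ≤ p.coeff k :=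
  ⟨fun h k => (h k).1, fun h k => ⟨h k, le_rfl⟩⟩

lemma CoeffLE.prod_self {α : Type*} (s : Finset α) {p : α → ℝ[X]}
    (h : ∀ x ∈ s, CoeffLE (p x) (p x)) : CoeffLE (∏ x ∈ s, p x) (∏ x ∈ s, p x) := by
  classical
  induction s using Finset.induction_on with
  | empty =>
    rw [coeffLE_refl_iff]
    intro k
    rw [Finset.prod_empty, coeff_one]
    positivity
  | insert x s hx ih =>
    rw [Finset.prod_insert hx]
    exact (h x (by simp)).mul (ih fun y hy => h y (by simp [hy]))

/-- Expanding the power gives the same sum of products with every weight equal to 1, and the `q i`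
have nonnegative coefficients. -/
lemma coeffLE_weighted {n m : ℕ} {a : (Fin m → Fin n) → ℝ} (ha : ∀ x, 0 ≤ a x ∧ a x ≤ 1)
    {q : Fin n → ℝ[X]} (hq : ∀ i, CoeffLE (q i) (q i)) :
    CoeffLE (∑ x : Fin m → Fin n, (∏ j, q (x j)) * C (a x)) ((∑ i, q i) ^ m) := by
  rw [Fintype.sum_pow]
  refine CoeffLE.sum _ fun x _ k => ?_
  have := (CoeffLE.prod_self univ (p := fun j => q (x j)) fun j _ => hq _) k
  rw [coeff_mul_C]
  exact ⟨mul_nonneg this.1 (ha x).1, mul_le_of_le_one_right this.1 (ha x).2⟩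

/-- In each intensity the Poissonized acceptance weight is a Poisson mixture of numbers
in `[0, 1]`. -/
lemma poissonized_update {n m : ℕ} {a : (Fin m → Fin n) → ℝ} (ha : ∀ x, 0 ≤ a x ∧ a x ≤ 1)
    (R : ℕ) {u : Fin n → ℝ} (hu : ∀ i, 0 ≤ u i) (i : Fin n) :
    ∃ g : ℕ → ℝ, (∀ k, 0 ≤ g k ∧ g k ≤ 1) ∧ ∀ t : ℝ,
      poissonized a R (Function.update u i t) =
        ∑ k ∈ range R, g k * (Real.exp (-t) * t ^ k / (k.factorial : ℝ)) := by
  set r : ℝ := ∑ l ∈ univ.erase i, u l with hr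
  have hr0 : 0 ≤ r := Finset.sum_nonneg fun l _ => hu l
  -- The intensity of coordinate `i` becomes the indeterminate and the others stay constants, so
  -- that the mixture weights can be read off as coefficients.
  set q : Fin n → ℝ[X] := fun l => if l = i then X else C (u l) with hq
  have hqs : ∑ l, q l = X + C r := by
    rw [← Finset.add_sum_erase _ _ (Finset.mem_univ i), hr, map_sum]
    congr 1
    · simp [hq]
    · exact Finset.sum_congr rfl fun l hl => by simp [hq, Finset.ne_of_mem_erase hl]
  have hq0 : ∀ l, CoeffLE (q l) (q l) := by
    intro l
    rw [coeffLE_refl_iff]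
    intro k
    simp only [hq]
    split_ifs
    · rw [coeff_X]; positivity
    · rw [coeff_C]; split_ifs
      · exact hu l
      · exact le_rfl
  set F : ℝ[X] := ∑ x : Fin m → Fin n, (∏ j, q (x j)) * C (a x) with hF
  have hFle : CoeffLE F ((X + C r) ^ m) := hqs ▸ coeffLE_weighted ha hq0
  have hXr : CoeffLE (X + C r) (X + C r) := by
    rw [coeffLE_refl_iff]
    intro k
    have := coeff_X_add_C_pow r 1 k
    rw [pow_one] at this
    rw [this]; positivity
  set T : ℕ → ℝ[X] := fun M => (X + C r) ^ (M - m) * F with hT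
  have hTle : ∀ M, m ≤ M → CoeffLE (T M) ((X + C r) ^ M) := by
    intro M hM
    have h1 : (X + C r) ^ M = (X + C r) ^ (M - m) * (X + C r) ^ m := by
      rw [← pow_add]; congr 1; omega
    rw [h1]
    refine CoeffLE.mul ?_ hFle
    have := CoeffLE.prod_self (range (M - m)) (p := fun _ => X + C r) fun _ _ => hXr
    simpa using this
  have hcoeff : ∀ M, m ≤ M → ∀ k, 0 ≤ (T M).coeff k ∧
      (T M).coeff k ≤ r ^ (M - k) * (M.choose k : ℝ) := by
    intro M hM k
    have := hTle M hM k
    rwa [coeff_X_add_C_pow] at this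
  -- The factor `exp (-t)` is split off from `exp (-(t + r))`. Domination by `(X + r) ^ M` bounds
  -- the rest by `exp (-r) * ∑ r ^ (M - k) / (M - k)!`, which is at most 1.
  refine ⟨fun k => Real.exp (-r) *
    ∑ M ∈ Ico m R, (k.factorial : ℝ) / (M.factorial : ℝ) * (T M).coeff k, fun k => ⟨?_, ?_⟩, ?_⟩
  · refine mul_nonneg (Real.exp_nonneg _) (Finset.sum_nonneg fun M hM => ?_)
    exact mul_nonneg (by positivity) (hcoeff M (Finset.mem_Ico.mp hM).1 k).1
  · have : ∑ M ∈ Ico m R, (k.factorial : ℝ) / (M.factorial : ℝ) * (T M).coeff k ≤ Real.exp r := by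
      calc _ ≤ ∑ M ∈ Ico m R, if k ≤ M then r ^ (M - k) / ((M - k).factorial : ℝ) else 0 := by
            refine Finset.sum_le_sum fun M hM => ?_
            have hb := (hcoeff M (Finset.mem_Ico.mp hM).1 k).2
            split_ifs with hk
            · refine (mul_le_mul_of_nonneg_left hb (by positivity)).trans (le_of_eq ?_)
              rw [Nat.cast_choose ℝ hk]
              field_simp
            · rw [Nat.choose_eq_zero_of_lt (by omega)] at hb
              have : (k.factorial : ℝ) / (M.factorial : ℝ) * (T M).coeff k ≤
                (k.factorial : ℝ) / (M.factorial : ℝ) * 0 :=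
                mul_le_mul_of_nonneg_left (by simpa using hb) (by positivity)
              simpa using this
        _ ≤ ∑ M ∈ range (R + k), if k ≤ M then r ^ (M - k) / ((M - k).factorial : ℝ) else 0 := by
            refine Finset.sum_le_sum_of_subset_of_nonneg (fun M hM => ?_) fun M _ _ => ?_
            · simp only [Finset.mem_Ico, Finset.mem_range] at *; omega
            · split_ifs <;> positivity
        _ = ∑ j ∈ range R, r ^ j / (j.factorial : ℝ) := by
            rw [add_comm R k, Finset.sum_range_add]
            rw [Finset.sum_eq_zero, zero_add]
            · simp
            · intro M hM
              rw [if_neg (by simpa using hM)]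
        _ ≤ Real.exp r := Real.sum_le_exp_of_nonneg hr0 R
    calc _ ≤ Real.exp (-r) * Real.exp r := mul_le_mul_of_nonneg_left this (Real.exp_nonneg _)
      _ = 1 := by rw [← Real.exp_add]; simp
  · intro t
    have hs : ∑ l, Function.update u i t l = t + r := by
      rw [← Finset.add_sum_erase _ _ (Finset.mem_univ i), Function.update_self, hr]
      congr 1
      exact Finset.sum_congr rfl fun l hl => by
        rw [Function.update_of_ne (Finset.ne_of_mem_erase hl)]
    have hev : ∀ l, (q l).eval t = Function.update u i t l := by
      intro l
      by_cases hl : l = i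
      · subst hl; simp [hq]
      · simp [hq, hl]
    have hFev : ∑ x, (∏ j, Function.update u i t (x j)) * a x = F.eval t := by
      rw [hF, eval_finsetSum]
      refine Finset.sum_congr rfl fun x _ => ?_
      rw [eval_mul, eval_C, eval_prod]
      simp [hev]
    have hTev : ∀ M ∈ Ico m R, (t + r) ^ (M - m) * F.eval t =
        ∑ k ∈ range R, (T M).coeff k * t ^ k := by
      intro M hM
      rw [Finset.mem_Ico] at hM
      have : (t + r) ^ (M - m) * F.eval t = (T M).eval t := by simp [hT]
      rw [this]
      refine eval_eq_sum_range' ?_ t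
      refine lt_of_le_of_lt (natDegree_le_iff_coeff_eq_zero.mpr fun k hk => ?_) hM.2
      have := hcoeff M hM.1 k
      rw [Nat.choose_eq_zero_of_lt hk] at this
      linarith [this.1, this.2, this.2.trans_eq (by simp : r ^ (M - k) * ((0 : ℕ) : ℝ) = 0)]
    unfold poissonized
    rw [hs, hFev]
    have h1 : ∑ M ∈ Ico m R, (t + r) ^ (M - m) / (M.factorial : ℝ) * F.eval t =
        ∑ M ∈ Ico m R, ∑ k ∈ range R, (T M).coeff k * t ^ k / (M.factorial : ℝ) := by
      refine Finset.sum_congr rfl fun M hM => ?_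
      rw [div_mul_eq_mul_div, hTev M hM, Finset.sum_div]
    rw [h1, Finset.sum_comm, Finset.mul_sum]
    refine Finset.sum_congr rfl fun k _ => ?_
    beta_reduce
    rw [neg_add, Real.exp_add, Finset.mul_sum, Finset.mul_sum, Finset.sum_mul]
    refine Finset.sum_congr rfl fun M _ => ?_
    have := Nat.factorial_ne_zero k
    field_simp

end Coordinate

/-! ### Truncated exponentials and moment matching for Poisson mixtures -/

lemma sum_Ico_pow_div_factorial_le {x : ℝ} (hx : 0 ≤ x) (n R : ℕ) :
    ∑ k ∈ Ico n R, x ^ k / (k.factorial : ℝ) ≤ x ^ n / (n.factorial : ℝ) * Real.exp x := by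
  rw [Finset.sum_Ico_eq_sum_range]
  calc _ ≤ ∑ i ∈ range (R - n), x ^ n / (n.factorial : ℝ) * (x ^ i / (i.factorial : ℝ)) := by
        refine Finset.sum_le_sum fun i _ => ?_
        rw [div_mul_div_comm, ← pow_add]
        have h : n.factorial * i.factorial ≤ (n + i).factorial :=
          Nat.le_of_dvd (Nat.factorial_pos _) (Nat.factorial_mul_factorial_dvd_factorial_add n i)
        have h' : (n.factorial : ℝ) * (i.factorial : ℝ) ≤ ((n + i).factorial : ℝ) := by
          exact_mod_cast h
        gcongr
    _ ≤ _ := by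
        rw [← Finset.mul_sum]
        exact mul_le_mul_of_nonneg_left (Real.sum_le_exp_of_nonneg hx _) (by positivity)

lemma tendsto_sum_pow_div_factorial (x : ℝ) :
    Filter.Tendsto (fun R => ∑ k ∈ range R, x ^ k / (k.factorial : ℝ)) Filter.atTop
      (nhds (Real.exp x)) := by
  rw [Real.exp_eq_exp_ℝ]
  exact (NormedSpace.expSeries_div_hasSum_exp x).tendsto_sum_nat

lemma exp_sub_sum_le {x : ℝ} (hx : 0 ≤ x) (n : ℕ) :
    Real.exp x - ∑ k ∈ range n, x ^ k / (k.factorial : ℝ) ≤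
      x ^ n / (n.factorial : ℝ) * Real.exp x := by
  refine le_of_tendsto ((tendsto_sum_pow_div_factorial x).sub_const _) ?_
  filter_upwards [Filter.eventually_ge_atTop n] with R hR
  rw [← Finset.sum_Ico_eq_sub _ hR]
  exact sum_Ico_pow_div_factorial_le hx n R

lemma abs_exp_neg_sub_sum_le {x : ℝ} (hx : 0 ≤ x) (n : ℕ) :
    |Real.exp (-x) - ∑ k ∈ range n, (-x) ^ k / (k.factorial : ℝ)| ≤
      x ^ n / (n.factorial : ℝ) * Real.exp x := by
  refine le_trans ?_ (exp_sub_sum_le hx n)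
  have := Complex.norm_exp_sub_sum_le_exp_norm_sub_sum ((-x : ℝ) : ℂ) n
  rw [Complex.norm_real, Real.norm_eq_abs, abs_neg, abs_of_nonneg hx] at this
  rw [← Real.norm_eq_abs, ← Complex.norm_real]
  exact_mod_cast this

/-- A Poisson mixture of numbers in `[0, 1]`, as a function of the intensity, is close to the
degree `< J` part of its power series. -/
lemma abs_poissonMix_sub_le {g : ℕ → ℝ} (hg : ∀ k, 0 ≤ g k ∧ g k ≤ 1) (R J : ℕ) {x : ℝ}
    (hx : 0 ≤ x) :
    |∑ k ∈ range R, g k * (Real.exp (-x) * x ^ k / (k.factorial : ℝ)) -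
      ∑ k ∈ range R, g k * ((∑ j ∈ range (J - k), (-x) ^ j / (j.factorial : ℝ)) * x ^ k /
        (k.factorial : ℝ))| ≤ 2 * ((2 * x) ^ J / (J.factorial : ℝ) * Real.exp x) := by
  have hterm : ∀ k, |g k * (Real.exp (-x) * x ^ k / (k.factorial : ℝ)) -
      g k * ((∑ j ∈ range (J - k), (-x) ^ j / (j.factorial : ℝ)) * x ^ k /
        (k.factorial : ℝ))| ≤ x ^ k / (k.factorial : ℝ) *
        |Real.exp (-x) - ∑ j ∈ range (J - k), (-x) ^ j / (j.factorial : ℝ)| := by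
    intro k
    have e : g k * (Real.exp (-x) * x ^ k / (k.factorial : ℝ)) -
      g k * ((∑ j ∈ range (J - k), (-x) ^ j / (j.factorial : ℝ)) * x ^ k /
        (k.factorial : ℝ)) = g k * (x ^ k / (k.factorial : ℝ) *
        (Real.exp (-x) - ∑ j ∈ range (J - k), (-x) ^ j / (j.factorial : ℝ))) := by ring
    have h0 : 0 ≤ x ^ k / (k.factorial : ℝ) := by positivity
    rw [e, abs_mul, abs_mul, abs_of_nonneg (hg k).1, abs_of_nonneg h0]
    exact mul_le_of_le_one_left (by positivity) (hg k).2
  have hE : (1 : ℝ) ≤ Real.exp x := Real.one_le_exp hx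
  -- For `k < J` the remainder of `exp (-x)` of order `J - k` multiplied by `x ^ k / k!` is `x ^ J /
  -- J!` times `J.choose k`, and the binomials sum to at most `2 ^ J`.
  have hlow : ∑ k ∈ range J, x ^ k / (k.factorial : ℝ) *
        |Real.exp (-x) - ∑ j ∈ range (J - k), (-x) ^ j / (j.factorial : ℝ)| ≤
        (2 * x) ^ J / (J.factorial : ℝ) * Real.exp x := by
    calc _ ≤ ∑ k ∈ range J, x ^ J / (J.factorial : ℝ) * Real.exp x * (J.choose k : ℝ) := by
          refine Finset.sum_le_sum fun k hk => ?_
          have hk' : k ≤ J := (Finset.mem_range.mp hk).le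
          refine (mul_le_mul_of_nonneg_left (abs_exp_neg_sub_sum_le hx (J - k))
            (by positivity)).trans (le_of_eq ?_)
          rw [Nat.cast_choose ℝ hk']
          have : x ^ J = x ^ k * x ^ (J - k) := by rw [← pow_add]; congr 1; omega
          rw [this]
          have h1 := Nat.factorial_ne_zero k
          have h2 := Nat.factorial_ne_zero J
          have h3 := Nat.factorial_ne_zero (J - k)
          field_simp
      _ ≤ x ^ J / (J.factorial : ℝ) * Real.exp x * 2 ^ J := by
          rw [← Finset.mul_sum]
          refine mul_le_mul_of_nonneg_left ?_ (by positivity)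
          have := Nat.sum_range_choose J
          rw [Finset.sum_range_succ] at this
          have h2 : ∑ k ∈ range J, J.choose k ≤ 2 ^ J := by omega
          exact_mod_cast h2
      _ = _ := by rw [mul_pow]; ring
  -- For `k ≥ J` the truncated sum is empty, so the whole term is error: a tail of the exponential
  -- series.
  have hhigh : ∑ k ∈ Ico J (R + J), x ^ k / (k.factorial : ℝ) *
        |Real.exp (-x) - ∑ j ∈ range (J - k), (-x) ^ j / (j.factorial : ℝ)| ≤
        (2 * x) ^ J / (J.factorial : ℝ) * Real.exp x := by
    calc _ ≤ ∑ k ∈ Ico J (R + J), x ^ k / (k.factorial : ℝ) := by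
          refine Finset.sum_le_sum fun k hk => ?_
          have hk' : J - k = 0 := by have := (Finset.mem_Ico.mp hk).1; omega
          rw [hk', Finset.range_zero, Finset.sum_empty, sub_zero, Real.abs_exp]
          exact mul_le_of_le_one_right (by positivity) (Real.exp_le_one_iff.mpr (by linarith))
      _ ≤ x ^ J / (J.factorial : ℝ) * Real.exp x := sum_Ico_pow_div_factorial_le hx J _
      _ ≤ _ := by
          gcongr
          linarith
  rw [← Finset.sum_sub_distrib]
  refine (Finset.abs_sum_le_sum_abs _ _).trans ?_
  calc _ ≤ ∑ k ∈ range R, x ^ k / (k.factorial : ℝ) *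
        |Real.exp (-x) - ∑ j ∈ range (J - k), (-x) ^ j / (j.factorial : ℝ)| :=
        Finset.sum_le_sum fun k _ => hterm k
    _ ≤ ∑ k ∈ range (R + J), x ^ k / (k.factorial : ℝ) *
        |Real.exp (-x) - ∑ j ∈ range (J - k), (-x) ^ j / (j.factorial : ℝ)| :=
        Finset.sum_le_sum_of_subset_of_nonneg (Finset.range_mono (by omega))
          fun k _ _ => by positivity
    _ ≤ _ := by
        rw [← Finset.sum_range_add_sum_Ico _ (by omega : J ≤ R + J)]
        linarith

/-- Moment matching up to degree `J - 1` makes Poisson mixtures nearly equal. -/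
lemma abs_sum_poissonMix_le {ι : Type*} [Fintype ι] {ν x : ι → ℝ} {J : ℕ} {X : ℝ}
    (hx : ∀ j, 0 ≤ x j ∧ x j ≤ X) (hν : ∀ k < J, ∑ j, ν j * x j ^ k = 0)
    {g : ℕ → ℝ} (hg : ∀ k, 0 ≤ g k ∧ g k ≤ 1) (R : ℕ) :
    |∑ j, ν j * ∑ k ∈ range R, g k * (Real.exp (-x j) * x j ^ k / (k.factorial : ℝ))| ≤
      (∑ j, |ν j|) * (2 * ((2 * X) ^ J / (J.factorial : ℝ) * Real.exp X)) := by
  have hz : ∑ j, ν j * ∑ k ∈ range R, g k * ((∑ i ∈ range (J - k),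
      (-x j) ^ i / (i.factorial : ℝ)) * x j ^ k / (k.factorial : ℝ)) = 0 := by
    have e : ∀ j, ν j * ∑ k ∈ range R, g k * ((∑ i ∈ range (J - k),
        (-x j) ^ i / (i.factorial : ℝ)) * x j ^ k / (k.factorial : ℝ)) =
        ∑ k ∈ range R, ∑ i ∈ range (J - k),
          g k / (k.factorial : ℝ) * ((-1) ^ i / (i.factorial : ℝ)) * (ν j * x j ^ (i + k)) := by
      intro j
      rw [Finset.mul_sum]
      refine Finset.sum_congr rfl fun k _ => ?_
      rw [Finset.sum_mul, Finset.sum_div, Finset.mul_sum, Finset.mul_sum]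
      refine Finset.sum_congr rfl fun i _ => ?_
      rw [neg_pow, pow_add]
      ring
    simp only [e]
    rw [Finset.sum_comm]
    refine Finset.sum_eq_zero fun k _ => ?_
    rw [Finset.sum_comm]
    refine Finset.sum_eq_zero fun i hi => ?_
    rw [← Finset.mul_sum, hν _ (by have := Finset.mem_range.mp hi; omega), mul_zero]
  rw [← sub_zero (∑ j, ν j * _), ← hz, ← Finset.sum_sub_distrib, Finset.sum_mul]
  refine (Finset.abs_sum_le_sum_abs _ _).trans (Finset.sum_le_sum fun j _ => ?_)
  rw [← mul_sub, abs_mul]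
  refine mul_le_mul_of_nonneg_left ((abs_poissonMix_sub_le hg R J (hx j).1).trans ?_) (abs_nonneg _)
  have h1 := (hx j).1
  have h2 := (hx j).2
  have h3 : 0 ≤ X := h1.trans h2
  gcongr

/-! ### Comparing the Poissonized weight with the tester -/

/-- A Chernoff bound: for `M < m` one has `s ^ M ≤ 2 ^ m * (s / 2) ^ M`, which leaves lower tail
mass at most `exp (-s / 4)`. The cutoff `R` only makes the sum finite and costs nothing in the
limit. -/
lemma eventually_poisson_Ico_ge {s : ℝ} {m : ℕ} (hs : 20 ≤ s) (hm : 4 * (m : ℝ) ≤ s) :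
    ∀ᶠ R in Filter.atTop,
      (98 / 100 : ℝ) ≤ Real.exp (-s) * ∑ M ∈ Ico m R, s ^ M / (M.factorial : ℝ) := by
  have hlow : ∑ M ∈ range m, s ^ M / (M.factorial : ℝ) ≤ Real.exp (3 / 4 * s) := by
    calc ∑ M ∈ range m, s ^ M / (M.factorial : ℝ)
        ≤ ∑ M ∈ range m, 2 ^ m * ((s / 2) ^ M / (M.factorial : ℝ)) := by
          refine Finset.sum_le_sum fun M hM => ?_
          have e : s ^ M = 2 ^ M * (s / 2) ^ M := by rw [← mul_pow]; congr 1; ring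
          rw [e, mul_div_assoc]
          refine mul_le_mul_of_nonneg_right ?_ (by positivity)
          exact pow_le_pow_right₀ (by norm_num) (Finset.mem_range.mp hM).le
      _ ≤ Real.exp (m : ℝ) * Real.exp (s / 2) := by
          rw [← Finset.mul_sum]
          refine mul_le_mul ?_ (Real.sum_le_exp_of_nonneg (by linarith) _) (by positivity)
            (by positivity)
          rw [← Real.exp_one_pow]
          refine pow_le_pow_left₀ (by norm_num) ?_ m
          linarith [Real.exp_one_gt_d9]
      _ ≤ Real.exp (3 / 4 * s) := by
          rw [← Real.exp_add]
          exact Real.exp_le_exp.mpr (by linarith)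
  have hsm : Real.exp (-s) * Real.exp (3 / 4 * s) ≤ 1 / 100 := by
    rw [← Real.exp_add]
    have h1 : Real.exp (-s + 3 / 4 * s) ≤ Real.exp (-5) := Real.exp_le_exp.mpr (by linarith)
    have h2 : (100 : ℝ) ≤ Real.exp 5 := by
      have : Real.exp 5 = Real.exp 1 ^ 5 := by rw [← Real.exp_nat_mul]; norm_num
      rw [this]
      calc (100 : ℝ) ≤ 2.7 ^ 5 := by norm_num
        _ ≤ _ := pow_le_pow_left₀ (by norm_num) (by linarith [Real.exp_one_gt_d9]) 5
    rw [Real.exp_neg] at h1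
    refine h1.trans ?_
    rw [one_div]
    exact inv_anti₀ (by norm_num) h2
  have hlim : Filter.Tendsto (fun R => Real.exp (-s) * ∑ k ∈ range R, s ^ k / (k.factorial : ℝ))
      Filter.atTop (nhds 1) := by
    have := (tendsto_sum_pow_div_factorial s).const_mul (Real.exp (-s))
    rwa [← Real.exp_add, neg_add_cancel, Real.exp_zero] at this
  filter_upwards [hlim.eventually (lt_mem_nhds (by norm_num : (99 / 100 : ℝ) < 1)),
    Filter.eventually_ge_atTop m] with R hR hmR
  rw [Finset.sum_Ico_eq_sub _ hmR, mul_sub]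
  have := mul_le_mul_of_nonneg_left hlow (Real.exp_nonneg (-s))
  linarith

/-- The product over samples is homogeneous of degree `m` in `u`, so normalising pulls out the
`m`-th power of the total intensity, which completes the Poisson weights. -/
lemma poissonized_eq_outputProb {n m : ℕ} (A : Algorithm n m) (b : Bool) (R : ℕ)
    {u : Fin n → ℝ} (hs : 0 < ∑ i, u i) :
    poissonized (fun x => (A x b).toReal) R u =
      outputProb A (fun i => u i / ∑ i, u i) b *
        (Real.exp (-∑ i, u i) * ∑ M ∈ Ico m R, (∑ i, u i) ^ M / (M.factorial : ℝ)) := by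
  set s : ℝ := ∑ i, u i
  have h : ∑ x : Fin m → Fin n, (∏ j, u (x j)) * (A x b).toReal =
      s ^ m * outputProb A (fun i => u i / s) b := by
    unfold outputProb
    rw [Finset.mul_sum]
    refine Finset.sum_congr rfl fun x _ => ?_
    rw [Finset.prod_div_distrib, Finset.prod_const, Finset.card_univ, Fintype.card_fin]
    field_simp
  unfold poissonized
  rw [h, mul_left_comm]
  refine congrArg (Real.exp (-s) * ·) ?_
  rw [Finset.mul_sum]
  refine Finset.sum_congr rfl fun M hM => ?_
  have : s ^ M = s ^ (M - m) * s ^ m := by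
    rw [← pow_add]; congr 1; have := (Finset.mem_Ico.mp hM).1; omega
  rw [this]
  ring

lemma toReal_apply_mem (p : PMF Bool) (b : Bool) : 0 ≤ (p b).toReal ∧ (p b).toReal ≤ 1 :=
  ⟨ENNReal.toReal_nonneg, ENNReal.toReal_le_of_le_ofReal zero_le_one (by simpa using p.coe_le_one b)⟩

lemma toReal_true_add_false (p : PMF Bool) : (p true).toReal + (p false).toReal = 1 := by
  have := p.tsum_coe
  rw [tsum_bool] at this
  rw [← ENNReal.toReal_add (p.apply_ne_top _) (p.apply_ne_top _), add_comm, this]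
  simp

lemma poissonized_true_add_false_le {n m : ℕ} (A : Algorithm n m) (R : ℕ)
    {u : Fin n → ℝ} (hu : ∀ i, 0 ≤ u i) :
    poissonized (fun x => (A x true).toReal) R u +
      poissonized (fun x => (A x false).toReal) R u ≤ 1 := by
  set s := ∑ i, u i with hs
  have hs0 : 0 ≤ s := Finset.sum_nonneg fun i _ => hu i
  have h : ∑ x : Fin m → Fin n, (∏ j, u (x j)) * (A x true).toReal +
      ∑ x : Fin m → Fin n, (∏ j, u (x j)) * (A x false).toReal = s ^ m := by
    rw [← Finset.sum_add_distrib, hs, Fintype.sum_pow]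
    refine Finset.sum_congr rfl fun x _ => ?_
    rw [← mul_add, toReal_true_add_false, mul_one]
  unfold poissonized
  rw [← mul_add, ← Finset.sum_add_distrib]
  have h2 : ∀ M ∈ Ico m R, s ^ (M - m) / (M.factorial : ℝ) *
      ∑ x : Fin m → Fin n, (∏ j, u (x j)) * (A x true).toReal + s ^ (M - m) / (M.factorial : ℝ) *
      ∑ x : Fin m → Fin n, (∏ j, u (x j)) * (A x false).toReal = s ^ M / (M.factorial : ℝ) := by
    intro M hM
    have : s ^ M = s ^ (M - m) * s ^ m := by
      rw [← pow_add]; congr 1; have := (Finset.mem_Ico.mp hM).1; omega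
    rw [← mul_add, h, this]
    ring
  rw [Finset.sum_congr rfl h2]
  have h3 : ∑ M ∈ Ico m R, s ^ M / (M.factorial : ℝ) ≤ Real.exp s :=
    (Finset.sum_le_sum_of_subset_of_nonneg (fun M hM => by
      simp only [Finset.mem_Ico, Finset.mem_range] at *; omega) fun M _ _ => by positivity).trans
      (Real.sum_le_exp_of_nonneg hs0 R)
  calc _ ≤ Real.exp (-s) * Real.exp s := mul_le_mul_of_nonneg_left h3 (Real.exp_nonneg _)
    _ = 1 := by rw [← Real.exp_add]; simp

/-! ### Tail bounds for the random intensities -/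

section Tails

variable {ι : Type*} [Fintype ι] {n : ℕ}

lemma iidExp_markov {P f : ι → ℝ} (hP : ∀ j, 0 ≤ P j) (hP1 : ∑ j, P j = 1) (hf : ∀ j, 0 ≤ f j)
    {B : ℝ} (hB : 0 < B) :
    iidExp P (fun v : Fin n → ι => if B < ∑ i, f (v i) then (1 : ℝ) else 0) ≤
      n * (∑ j, P j * f j) / B := by
  rw [← iidExp_sum_coord P hP1 f, div_eq_inv_mul, ← iidExp_const_mul]
  refine iidExp_mono hP fun v _ => ?_
  have h0 : 0 ≤ ∑ i, f (v i) := Finset.sum_nonneg fun i _ => hf _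
  split_ifs with h
  · rw [← div_eq_inv_mul, one_le_div hB]
    exact h.le
  · positivity

/-- Exponential Markov inequality for `2 ^ (-count)`, whose expectation factors as `(1 - P z / 2) ^
n`. -/
lemma iidExp_few_le [DecidableEq ι] {P : ι → ℝ} (hP : ∀ j, 0 ≤ P j) (hP1 : ∑ j, P j = 1) (z : ι) :
    iidExp P (fun v : Fin n → ι =>
      if (#{i | v i = z} : ℝ) < n * P z / 4 then (1 : ℝ) else 0) ≤
      Real.exp (-(n * P z / 4)) := by
  have hsum : ∑ j, P j * (if j = z then (1 / 2 : ℝ) else 1) = 1 - P z / 2 := by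
    have : ∀ j, P j * (if j = z then (1 / 2 : ℝ) else 1) = P j - if j = z then P j / 2 else 0 := by
      intro j; split_ifs <;> ring
    rw [Finset.sum_congr rfl fun j _ => this j, Finset.sum_sub_distrib, hP1]
    simp
  have hle : P z ≤ 1 := hP1 ▸ Finset.single_le_sum (fun j _ => hP j) (Finset.mem_univ z)
  calc _ ≤ iidExp P (fun v : Fin n → ι => Real.exp (n * P z / 4) *
        ∏ i, if v i = z then (1 / 2 : ℝ) else 1) := by
        refine iidExp_mono hP fun v _ => ?_
        have e : ∏ i, (if v i = z then (1 / 2 : ℝ) else 1) = (1 / 2) ^ #{i | v i = z} := by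
          rw [Finset.prod_ite]
          simp
        rw [e]
        split_ifs with h
        · have h1 : Real.exp (-1) ≤ 1 / 2 := by
            rw [Real.exp_neg, one_div]
            exact inv_anti₀ (by norm_num) (by linarith [Real.exp_one_gt_d9])
          have h2 : Real.exp (-(#{i | v i = z} : ℝ)) ≤ (1 / 2) ^ #{i | v i = z} := by
            have : Real.exp (-(#{i | v i = z} : ℝ)) = Real.exp (-1) ^ #{i | v i = z} := by
              rw [← Real.exp_nat_mul]; ring_nf
            rw [this]
            exact pow_le_pow_left₀ (Real.exp_nonneg _) h1 _
          calc (1 : ℝ) ≤ Real.exp (n * P z / 4) * Real.exp (-(#{i | v i = z} : ℝ)) := by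
                rw [← Real.exp_add]
                exact Real.one_le_exp (by linarith)
            _ ≤ _ := mul_le_mul_of_nonneg_left h2 (Real.exp_nonneg _)
        · positivity
    _ = Real.exp (n * P z / 4) * (1 - P z / 2) ^ n := by
        rw [iidExp_const_mul, iidExp_prod P (fun _ j => if j = z then (1 / 2 : ℝ) else 1)]
        simp only [hsum, Finset.prod_const, Finset.card_univ, Fintype.card_fin]
    _ ≤ Real.exp (n * P z / 4) * Real.exp (-(n * P z / 2)) := by
        refine mul_le_mul_of_nonneg_left ?_ (Real.exp_nonneg _)
        have : Real.exp (-(n * P z / 2)) = Real.exp (-(P z / 2)) ^ n := by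
          rw [← Real.exp_nat_mul]; ring_nf
        rw [this]
        exact pow_le_pow_left₀ (by linarith) (Real.one_sub_le_exp_neg _) n
    _ = _ := by rw [← Real.exp_add]; ring_nf

end Tails

/-! ### Explicit nodes and divided difference weights -/

section Nodes

/-- Since `|i² - k²| = |i - k| (i + k)`, the product over `k ≠ i` telescopes to `d! (d + 2i)! / 2`
for `i ≥ 1`. For `i = 0` it is `d!²`, and the factor 2 is spare. -/
lemma factorial_le_two_mul_prod (i d : ℕ) :
    ((d.factorial * (d + 2 * i).factorial : ℕ) : ℝ) ≤
      2 * ∏ k ∈ range (i + d + 1), if k = i then (1 : ℝ) else |(i : ℝ) ^ 2 - (k : ℝ) ^ 2| := by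
  induction d with
  | zero =>
    have e : ∏ k ∈ range (i + 0 + 1), (if k = i then (1 : ℝ) else |(i : ℝ) ^ 2 - (k : ℝ) ^ 2|) =
        ((∏ k ∈ range i, (i - k)) * ∏ k ∈ range i, (i + k) : ℕ) := by
      rw [add_zero, Finset.prod_range_succ, if_pos rfl, mul_one, ← Finset.prod_mul_distrib,
        Nat.cast_prod]
      refine Finset.prod_congr rfl fun k hk => ?_
      have hk' := Finset.mem_range.mp hk
      have : (k : ℝ) < i := by exact_mod_cast hk'
      have hk0 : (0 : ℝ) ≤ k := Nat.cast_nonneg k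
      rw [if_neg hk'.ne, abs_of_nonneg (by nlinarith), Nat.cast_mul, Nat.cast_sub hk'.le,
        Nat.cast_add]
      ring
    rw [e, ← Nat.descFactorial_eq_prod_range, Nat.descFactorial_self,
      ← Nat.ascFactorial_eq_prod_range]
    norm_cast
    rcases i with _ | j
    · simp
    · have h := Nat.factorial_mul_ascFactorial j (j + 1)
      have h2 : (0 + 2 * (j + 1)).factorial = 2 * (j + 1) * (j + (j + 1)).factorial := by
        have : 0 + 2 * (j + 1) = (j + (j + 1)) + 1 := by ring
        rw [this, Nat.factorial_succ]
        ring
      rw [h2, ← h, Nat.factorial_succ]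
      apply le_of_eq
      simp
      ring
  | succ d ih =>
    have e : i + (d + 1) + 1 = (i + d + 1) + 1 := by ring
    rw [e, Finset.prod_range_succ, if_neg (by omega), ← mul_assoc]
    have h1 : |(i : ℝ) ^ 2 - ((i + d + 1 : ℕ) : ℝ) ^ 2| = ((d + 1) * (d + 2 * i + 1) : ℕ) := by
      rw [abs_sub_comm, abs_of_nonneg]
      · push_cast; ring
      · push_cast
        nlinarith [Nat.cast_nonneg (α := ℝ) i, Nat.cast_nonneg (α := ℝ) d]
    rw [h1]
    have h2 : (d + 1).factorial * (d + 1 + 2 * i).factorial =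
        (d.factorial * (d + 2 * i).factorial) * ((d + 1) * (d + 2 * i + 1)) := by
      have : d + 1 + 2 * i = (d + 2 * i) + 1 := by ring
      rw [this, Nat.factorial_succ, Nat.factorial_succ]
      ring
    rw [h2, Nat.cast_mul]
    exact mul_le_mul_of_nonneg_right ih (Nat.cast_nonneg _)

/-- By the previous bound it suffices that `N!² ≤ (N - i)! (N + i)!`, which says that the central
binomial coefficient of `2N` is the largest. -/
lemma sq_factorial_le_two_mul_prod {i N : ℕ} (hi : i ≤ N) :
    (N.factorial : ℝ) ^ 2 ≤
      2 * ∏ k ∈ range (N + 1), if k = i then (1 : ℝ) else |(i : ℝ) ^ 2 - (k : ℝ) ^ 2| := by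
  obtain ⟨d, rfl⟩ := Nat.exists_eq_add_of_le hi
  refine le_trans ?_ (factorial_le_two_mul_prod i d)
  have h1 := Nat.choose_le_centralBinom d (i + d)
  have h2 := Nat.choose_mul_factorial_mul_factorial (show d ≤ 2 * (i + d) by omega)
  have h3 := Nat.choose_mul_factorial_mul_factorial (show i + d ≤ 2 * (i + d) by omega)
  rw [show 2 * (i + d) - d = d + 2 * i by omega] at h2
  rw [show 2 * (i + d) - (i + d) = i + d by omega, ← Nat.centralBinom_eq_two_mul_choose] at h3
  have hpos : 0 < (i + d).centralBinom := Nat.centralBinom_pos _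
  have : (i + d).factorial ^ 2 ≤ d.factorial * (d + 2 * i).factorial := by
    refine Nat.le_of_mul_le_mul_left ?_ hpos
    calc (i + d).centralBinom * (i + d).factorial ^ 2
        = (2 * (i + d)).factorial := by rw [← h3]; ring
      _ = (2 * (i + d)).choose d * (d.factorial * (d + 2 * i).factorial) := by rw [← h2]; ring
      _ ≤ _ := Nat.mul_le_mul_right _ h1
  exact_mod_cast this

lemma prod_one_add_sq_div_le {D : ℕ} (hD : 1 ≤ D) (N : ℕ) :
    ∏ k ∈ range N, (1 + (D : ℝ) ^ 2 / ((k : ℝ) + 1) ^ 2) ≤ Real.exp (4 * D) := by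
  have hD0 : (0 : ℝ) < D := by exact_mod_cast hD
  -- The first `D` factors are at most `2 D² / (k + 1)²`, and `D ^ D / D! ≤ exp D`. Beyond `D`, `1 +
  -- u ≤ exp u` and a telescoping bound for the inverse squares cost only `exp D`.
  have h1 : ∏ k ∈ range D, (1 + (D : ℝ) ^ 2 / ((k : ℝ) + 1) ^ 2) ≤ Real.exp (3 * D) := by
    calc _ ≤ ∏ k ∈ range D, (2 * (D : ℝ) ^ 2 / ((k : ℝ) + 1) ^ 2) := by
          refine Finset.prod_le_prod (fun k _ => by positivity) fun k hk => ?_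
          have : (k : ℝ) + 1 ≤ D := by exact_mod_cast Finset.mem_range.mp hk
          have h2 : 1 ≤ (D : ℝ) ^ 2 / ((k : ℝ) + 1) ^ 2 := by
            rw [one_le_div (by positivity)]
            gcongr
          rw [mul_div_assoc]
          linarith
      _ = 2 ^ D * ((D : ℝ) ^ D / (D.factorial : ℝ)) ^ 2 := by
          rw [Finset.prod_div_distrib, Finset.prod_const, Finset.card_range, Finset.prod_pow,
            ← Finset.prod_range_add_one_eq_factorial]
          push_cast
          rw [mul_pow]
          ring
      _ ≤ Real.exp D * Real.exp D ^ 2 := by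
          refine mul_le_mul ?_ ?_ (by positivity) (by positivity)
          · rw [← Real.exp_one_pow]
            exact pow_le_pow_left₀ (by norm_num) (by linarith [Real.exp_one_gt_d9]) D
          · exact pow_le_pow_left₀ (by positivity) (Real.pow_div_factorial_le_exp _ hD0.le D) 2
      _ = Real.exp (3 * D) := by rw [← pow_succ', ← Real.exp_nat_mul]; norm_num
  have hs : ∑ k ∈ range N, (1 : ℝ) / ((D : ℝ) + k + 1) ^ 2 ≤
      1 / (D : ℝ) - 1 / ((D : ℝ) + N) := by
    induction N with
    | zero => simp
    | succ N ih =>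
      rw [Finset.sum_range_succ]
      have : (1 : ℝ) / ((D : ℝ) + N + 1) ^ 2 ≤
          1 / ((D : ℝ) + N) - 1 / ((D : ℝ) + ((N + 1 : ℕ) : ℝ)) := by
        push_cast
        rw [div_sub_div _ _ (by positivity) (by positivity), div_le_div_iff₀ (by positivity)
          (by positivity)]
        nlinarith [Nat.cast_nonneg (α := ℝ) N]
      linarith
  have h2 : ∏ k ∈ range N, (1 + (D : ℝ) ^ 2 / (((D + k : ℕ) : ℝ) + 1) ^ 2) ≤ Real.exp D := by
    refine (Real.prod_one_add_le_exp_sum _ fun k => by positivity).trans ?_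
    refine Real.exp_le_exp.mpr ?_
    calc _ = (D : ℝ) ^ 2 * ∑ k ∈ range N, (1 : ℝ) / ((D : ℝ) + k + 1) ^ 2 := by
          rw [Finset.mul_sum]
          exact Finset.sum_congr rfl fun k _ => by push_cast; ring
      _ ≤ (D : ℝ) ^ 2 * (1 / D) := by
          refine mul_le_mul_of_nonneg_left (hs.trans ?_) (by positivity)
          have : (0 : ℝ) ≤ 1 / ((D : ℝ) + N) := by positivity
          linarith
      _ = D := by field_simp
  calc _ ≤ ∏ k ∈ range (D + N), (1 + (D : ℝ) ^ 2 / ((k : ℝ) + 1) ^ 2) := by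
        refine Finset.prod_le_prod_of_subset_of_one_le (Finset.range_mono (by omega))
          (fun k _ => by positivity) fun k _ _ => ?_
        have : (0 : ℝ) ≤ (D : ℝ) ^ 2 / ((k : ℝ) + 1) ^ 2 := by positivity
        linarith
    _ ≤ Real.exp (3 * D) * Real.exp D := by
        rw [Finset.prod_range_add]
        exact mul_le_mul h1 h2 (Finset.prod_nonneg fun k _ => by positivity) (by positivity)
    _ = _ := by rw [← Real.exp_add]; ring_nf

lemma prod_sq_add_sq_le {D : ℕ} (hD : 1 ≤ D) (N : ℕ) :
    ∏ k ∈ range (N + 1), ((D : ℝ) ^ 2 + (k : ℝ) ^ 2) ≤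
      (D : ℝ) ^ 2 * ((N.factorial : ℝ) ^ 2 * Real.exp (4 * D)) := by
  rw [Finset.prod_range_succ', mul_comm]
  push_cast
  have e : ∏ k ∈ range N, ((D : ℝ) ^ 2 + ((k : ℝ) + 1) ^ 2) =
      (N.factorial : ℝ) ^ 2 * ∏ k ∈ range N, (1 + (D : ℝ) ^ 2 / ((k : ℝ) + 1) ^ 2) := by
    rw [← Finset.prod_range_add_one_eq_factorial]
    push_cast
    rw [← Finset.prod_pow, ← Finset.prod_mul_distrib]
    refine Finset.prod_congr rfl fun k _ => ?_
    field_simp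
    ring
  rw [e, zero_pow two_ne_zero, add_zero]
  gcongr
  exact prod_one_add_sq_div_le hD N

lemma sum_inv_sq_sub_quarter_le (N : ℕ) :
    ∑ i ∈ range (N + 1), 1 / |(i : ℝ) ^ 2 - 1 / 4| ≤ 6 := by
  have h : ∑ i ∈ range N, 1 / |(((i + 1 : ℕ) : ℝ)) ^ 2 - 1 / 4| ≤ 2 - 1 / ((N : ℝ) + 1 / 2) := by
    induction N with
    | zero => norm_num
    | succ N ih =>
      rw [Finset.sum_range_succ]
      have hN := Nat.cast_nonneg (α := ℝ) N
      have : 1 / |((N + 1 : ℕ) : ℝ) ^ 2 - 1 / 4| =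
          1 / ((N : ℝ) + 1 / 2) - 1 / (((N + 1 : ℕ) : ℝ) + 1 / 2) := by
        push_cast
        rw [abs_of_nonneg (by nlinarith)]
        have h1 : ((N : ℝ) + 1) ^ 2 - 1 / 4 = (N + 1 / 2) * (N + 1 + 1 / 2) := by ring
        rw [h1]
        field_simp
        ring
      linarith
  rw [Finset.sum_range_succ']
  have h0 : 1 / |(((0 : ℕ) : ℝ)) ^ 2 - 1 / 4| = 4 := by norm_num [abs_of_neg]
  have h1 : (0 : ℝ) ≤ 1 / ((N : ℝ) + 1 / 2) := by positivity
  linarith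

/-- The interpolation nodes `0`, `D² + 1/4`, and `D² + i²` for `i = 0, 1, 2, …`. -/
noncomputable def node (D : ℕ) : ℕ → ℝ
  | 0 => 0
  | 1 => (D : ℝ) ^ 2 + 1 / 4
  | i + 2 => (D : ℝ) ^ 2 + (i : ℝ) ^ 2

lemma node_injective {D : ℕ} (hD : 1 ≤ D) : Function.Injective (node D) := by
  have hD0 : (0 : ℝ) < (D : ℝ) ^ 2 := by
    have : (0 : ℝ) < D := by exact_mod_cast hD
    positivity
  have hq : ∀ i : ℕ, (i : ℝ) ^ 2 ≠ 1 / 4 := by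
    intro i h
    have : (4 * i ^ 2 : ℕ) = 1 := by
      have : (4 : ℝ) * (i : ℝ) ^ 2 = 1 := by linarith
      exact_mod_cast this
    omega
  have h0 : ∀ i : ℕ, (D : ℝ) ^ 2 + (i : ℝ) ^ 2 ≠ 0 := fun i => by positivity
  intro a b hab
  match a, b with
  | 0, 0 => rfl
  | 0, 1 => simp only [node] at hab; linarith
  | 1, 0 => simp only [node] at hab; linarith
  | 1, 1 => rfl
  | 0, i + 2 => exact absurd hab.symm (h0 i)
  | i + 2, 0 => exact absurd hab (h0 i)
  | 1, i + 2 => simp only [node] at hab; exact absurd (by linarith) (hq i)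
  | i + 2, 1 => simp only [node] at hab; exact absurd (by linarith) (hq i)
  | i + 2, j + 2 =>
    simp only [node, add_right_inj] at hab
    have := (pow_left_inj₀ (Nat.cast_nonneg i) (Nat.cast_nonneg j) two_ne_zero).mp hab
    rw [Nat.cast_inj.mp this]

/-- The divided difference weights of the first `N + 3` nodes. -/
noncomputable def nodeWeight (D N i : ℕ) : ℝ :=
  1 / ∏ j ∈ (range (N + 3)).erase i, (node D i - node D j)

/-- A divided difference is the leading coefficient of the interpolating polynomial, and with `N +
3` nodes that coefficient, of degree `N + 2`, vanishes for lower powers. -/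
lemma sum_nodeWeight_mul_pow {D : ℕ} (hD : 1 ≤ D) {N k : ℕ} (hk : k < N + 2) :
    ∑ i ∈ range (N + 3), nodeWeight D N i * node D i ^ k = 0 := by
  have h := Lagrange.coeff_eq_sum (s := range (N + 3)) (v := node D)
    (node_injective hD).injOn (P := (Polynomial.X : Polynomial ℝ) ^ k) (by
      rw [Polynomial.degree_X_pow, Finset.card_range]
      exact_mod_cast (by omega : k < N + 3))
  rw [Polynomial.coeff_X_pow, if_neg (by rw [Finset.card_range]; omega)] at h
  rw [h]
  refine Finset.sum_congr rfl fun i _ => ?_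
  simp [nodeWeight, div_eq_inv_mul]

lemma abs_nodeWeight (D N i : ℕ) : |nodeWeight D N i| =
    1 / ∏ j ∈ range (N + 3), if j = i then 1 else |node D i - node D j| := by
  rw [nodeWeight, abs_div, abs_one, Finset.abs_prod]
  refine congrArg (1 / ·) ?_
  rw [← Finset.prod_erase (range (N + 3)) (a := i) (f := fun j =>
    if j = i then (1 : ℝ) else |node D i - node D j|) (if_pos rfl)]
  exact Finset.prod_congr rfl fun j hj => by rw [if_neg (Finset.ne_of_mem_erase hj)]

lemma abs_nodeWeight_zero_ge {D : ℕ} (hD : 1 ≤ D) (N : ℕ) :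
    1 / (2 * (D : ℝ) ^ 4 * (N.factorial : ℝ) ^ 2 * Real.exp (4 * D)) ≤ |nodeWeight D N 0| := by
  have hD0 : (1 : ℝ) ≤ D := by exact_mod_cast hD
  rw [abs_nodeWeight, Finset.prod_range_succ', Finset.prod_range_succ']
  have e : ∏ k ∈ range (N + 1), (if k + 1 + 1 = 0 then (1 : ℝ)
      else |node D 0 - node D (k + 1 + 1)|) = ∏ k ∈ range (N + 1), ((D : ℝ) ^ 2 + (k : ℝ) ^ 2) := by
    refine Finset.prod_congr rfl fun k _ => ?_
    rw [if_neg (by omega)]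
    simp only [node, zero_sub, abs_neg]
    exact abs_of_nonneg (by positivity)
  rw [e, if_neg (by omega), if_pos rfl, mul_one]
  have h1 : |node D 0 - node D (0 + 1)| = (D : ℝ) ^ 2 + 1 / 4 := by
    simp only [node, zero_sub, abs_neg]
    exact abs_of_nonneg (by positivity)
  rw [h1]
  have hp : 0 < ∏ k ∈ range (N + 1), ((D : ℝ) ^ 2 + (k : ℝ) ^ 2) :=
    Finset.prod_pos fun k _ => by positivity
  refine one_div_le_one_div_of_le (by positivity) ?_
  calc _ ≤ (D : ℝ) ^ 2 * ((N.factorial : ℝ) ^ 2 * Real.exp (4 * D)) * (2 * (D : ℝ) ^ 2) := by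
        refine mul_le_mul (prod_sq_add_sq_le hD N) (by nlinarith) (by positivity) (by positivity)
    _ = _ := by ring

/-- Multiplying by the node cancels the factor from the node 0. The node `D² + 1/4` supplies the
summable factor `1 / |i² - 1/4|`, which keeps the total free of a factor `N`. -/
lemma abs_nodeWeight_mul_node_le {D : ℕ} (hD : 1 ≤ D) {N i : ℕ} (hi : i ≤ N) :
    |nodeWeight D N (i + 2)| * node D (i + 2) ≤
      2 / (N.factorial : ℝ) ^ 2 * (1 / |(i : ℝ) ^ 2 - 1 / 4|) := by
  have hD0 : (1 : ℝ) ≤ D := by exact_mod_cast hD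
  rw [abs_nodeWeight, Finset.prod_range_succ', Finset.prod_range_succ']
  have e : ∏ k ∈ range (N + 1), (if k + 1 + 1 = i + 2 then (1 : ℝ)
      else |node D (i + 2) - node D (k + 1 + 1)|) =
      ∏ k ∈ range (N + 1), if k = i then (1 : ℝ) else |(i : ℝ) ^ 2 - (k : ℝ) ^ 2| := by
    refine Finset.prod_congr rfl fun k _ => ?_
    simp only [node, add_sub_add_left_eq_sub, Nat.add_right_cancel_iff]
  rw [e, if_neg (by omega), if_neg (by omega)]
  have h1 : |node D (i + 2) - node D (0 + 1)| = |(i : ℝ) ^ 2 - 1 / 4| := by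
    simp only [node, add_sub_add_left_eq_sub]
  have h2 : |node D (i + 2) - node D 0| = node D (i + 2) := by
    simp only [node, sub_zero]
    exact abs_of_nonneg (by positivity)
  have h3 : 0 < node D (i + 2) := by simp only [node]; positivity
  rw [h1, h2]
  have hp := sq_factorial_le_two_mul_prod hi
  set p := ∏ k ∈ range (N + 1), if k = i then (1 : ℝ) else |(i : ℝ) ^ 2 - (k : ℝ) ^ 2|
  have hf : (0 : ℝ) < (N.factorial : ℝ) ^ 2 := by positivity
  have hp0 : 0 < p := by linarith
  have e2 : 1 / (p * |(i : ℝ) ^ 2 - 1 / 4| * node D (i + 2)) * node D (i + 2) =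
      1 / p * (1 / |(i : ℝ) ^ 2 - 1 / 4|) := by
    field_simp
  rw [e2]
  refine mul_le_mul_of_nonneg_right ?_ (by positivity)
  rw [div_le_div_iff₀ hp0 hf]
  linarith

lemma node_nonneg (D i : ℕ) : 0 ≤ node D i := by
  match i with
  | 0 => exact le_rfl
  | 1 => simp only [node]; positivity
  | i + 2 => simp only [node]; positivity

lemma sum_abs_nodeWeight_mul_node_le {D : ℕ} (hD : 1 ≤ D) (N : ℕ) :
    ∑ i ∈ range (N + 3), |nodeWeight D N i| * node D i ≤ 24 / (N.factorial : ℝ) ^ 2 := by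
  have h1 : ∑ i ∈ range (N + 1), |nodeWeight D N (i + 2)| * node D (i + 2) ≤
      12 / (N.factorial : ℝ) ^ 2 := by
    calc _ ≤ ∑ i ∈ range (N + 1), 2 / (N.factorial : ℝ) ^ 2 * (1 / |(i : ℝ) ^ 2 - 1 / 4|) :=
          Finset.sum_le_sum fun i hi =>
            abs_nodeWeight_mul_node_le hD (by have := Finset.mem_range.mp hi; omega)
      _ ≤ 2 / (N.factorial : ℝ) ^ 2 * 6 := by
          rw [← Finset.mul_sum]
          exact mul_le_mul_of_nonneg_left (sum_inv_sq_sub_quarter_le N) (by positivity)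
      _ = _ := by ring
  have h2 := sum_nodeWeight_mul_pow hD (show 1 < N + 2 by omega)
  simp only [pow_one] at h2
  rw [Finset.sum_range_succ', Finset.sum_range_succ'] at h2 ⊢
  have hz : node D 0 = 0 := rfl
  rw [hz, mul_zero, add_zero] at h2 ⊢
  -- The node `D² + 1/4` needs no product estimate: the first moment vanishes, so its term is
  -- bounded by all the others together.
  have h3 : |nodeWeight D N (0 + 1)| * node D (0 + 1) ≤
      ∑ i ∈ range (N + 1), |nodeWeight D N (i + 1 + 1)| * node D (i + 1 + 1) := by
    have e : nodeWeight D N (0 + 1) * node D (0 + 1) =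
        -∑ i ∈ range (N + 1), nodeWeight D N (i + 1 + 1) * node D (i + 1 + 1) := by linarith
    calc _ = |nodeWeight D N (0 + 1) * node D (0 + 1)| := by
          rw [abs_mul, abs_of_nonneg (node_nonneg D _)]
      _ ≤ _ := by
          rw [e, abs_neg]
          refine (Finset.abs_sum_le_sum_abs _ _).trans (le_of_eq ?_)
          exact Finset.sum_congr rfl fun i _ => by rw [abs_mul, abs_of_nonneg (node_nonneg D _)]
  have h4 : (24 : ℝ) / (N.factorial : ℝ) ^ 2 = 12 / (N.factorial : ℝ) ^ 2 +
    12 / (N.factorial : ℝ) ^ 2 := by ring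
  linarith

end Nodes

/-! ### The two priors -/

/-- Splitting a signed weight with vanishing moments into two laws with equal moments. -/
lemma exists_moment_matching_laws {ι : Type*} [Fintype ι] {x w : ι → ℝ} {J : ℕ} (hJ : 2 ≤ J)
    (hw : ∀ k < J, ∑ j, w j * x j ^ k = 0) {z o : ι} (hz : x z = 0) (ho : x o = 1)
    (hx : ∀ j ≠ z, 1 ≤ x j) (hwz : w z ≠ 0) :
    ∃ P Q : ι → ℝ, (∀ j, 0 ≤ P j) ∧ (∀ j, 0 ≤ Q j) ∧ ∑ j, P j = 1 ∧ ∑ j, Q j = 1 ∧ P z = 0 ∧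
      0 < ∑ j, |w j| * x j ∧ Q z = |w z| / (100 * ∑ j, |w j| * x j) ∧ Q z ≤ 1 / 100 ∧
      (∀ k < J, ∑ j, (P j - Q j) * x j ^ k = 0) ∧ ∑ j, P j * x j ≤ 2 := by
  classical
  have hx0 : ∀ j, 0 ≤ x j := fun j => by
    by_cases h : j = z
    · rw [h, hz]
    · linarith [hx j h]
  set S := ∑ j, |w j| * x j with hS
  have hS0 : 0 < S := by
    have h0 : ∀ j, 0 ≤ |w j| * x j := fun j => mul_nonneg (abs_nonneg _) (hx0 j)
    refine lt_of_le_of_ne (Finset.sum_nonneg fun j _ => h0 j) fun h => hwz ?_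
    have h1 := (Finset.sum_eq_zero_iff_of_nonneg fun j _ => h0 j).mp h.symm
    have h2 : ∀ j ≠ z, w j = 0 := fun j hj => by
      have := h1 j (Finset.mem_univ j)
      rcases mul_eq_zero.mp this with h | h
      · exact abs_eq_zero.mp h
      · linarith [hx j hj]
    have h3 := hw 0 (by omega)
    simp only [pow_zero, mul_one] at h3
    rwa [Finset.sum_eq_single z (fun j _ hj => h2 j hj) (by simp)] at h3
  -- The sign of `κ` puts the atom at `z` into the negative part, hence into `Q`; its size makes the
  -- first absolute moment equal to `1 / 100`.
  obtain ⟨κ, hκ, hκz⟩ : ∃ κ : ℝ, |κ| = 1 / (100 * S) ∧ κ * w z ≤ 0 := by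
    rcases le_total 0 (w z) with h | h
    · refine ⟨-(1 / (100 * S)), by rw [abs_neg, abs_of_pos (by positivity)], ?_⟩
      have : 0 ≤ 1 / (100 * S) * w z := by positivity
      linarith
    · exact ⟨1 / (100 * S), abs_of_pos (by positivity),
        mul_nonpos_of_nonneg_of_nonpos (by positivity) h⟩
  set ν : ι → ℝ := fun j => κ * w j with hν
  have hνk : ∀ k < J, ∑ j, ν j * x j ^ k = 0 := fun k hk => by
    simp only [hν, mul_assoc, ← Finset.mul_sum, hw k hk, mul_zero]
  have habs : ∑ j, |ν j| * x j = 1 / 100 := by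
    simp only [hν, abs_mul, mul_assoc, ← Finset.mul_sum, hκ, ← hS]
    field_simp
  set σ := ∑ j, max (ν j) 0 with hσ
  have hpm : ∀ j, max (ν j) 0 - max (-ν j) 0 = ν j := fun j => max_zero_sub_eq_self _
  have hσ' : ∑ j, max (-ν j) 0 = σ := by
    have h0 := hνk 0 (by omega)
    simp only [pow_zero, mul_one] at h0
    have : ∑ j, (max (ν j) 0 - max (-ν j) 0) = 0 :=
      (Finset.sum_congr rfl fun j _ => hpm j).trans h0
    rw [Finset.sum_sub_distrib] at this
    linarith
  have hmean : ∑ j, max (ν j) 0 * x j ≤ 1 / 100 := by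
    rw [← habs]
    refine Finset.sum_le_sum fun j _ => mul_le_mul_of_nonneg_right ?_ (hx0 j)
    exact max_le (le_abs_self _) (abs_nonneg _)
  have hσle : σ ≤ 1 / 100 := by
    refine le_trans (Finset.sum_le_sum fun j _ => ?_) hmean
    by_cases h : j = z
    · have : max (ν j) 0 = 0 := max_eq_right (by rw [h]; exact hκz)
      rw [this, zero_mul]
    · exact le_mul_of_one_le_right (le_max_right _ _) (hx j h)
  have hoz : z ≠ o := fun h => by rw [h, ho] at hz; norm_num at hz
  have hσ1 : 0 ≤ 1 - σ := by linarith
  have hQz : max (-ν z) 0 = |w z| / (100 * S) := by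
    rw [max_eq_left (by simpa [hν] using hκz), ← abs_of_nonpos (a := ν z) hκz]
    simp only [hν, abs_mul, hκ]
    ring
  -- Both parts have the same mass `σ ≤ 1 / 100`. The missing `1 - σ` goes to the intensity 1 in
  -- both laws, which preserves moment matching and keeps the mean bounded.
  refine ⟨fun j => max (ν j) 0 + if j = o then 1 - σ else 0,
    fun j => max (-ν j) 0 + if j = o then 1 - σ else 0, fun j => ?_, fun j => ?_, ?_, ?_, ?_, hS0, ?_,
    ?_, fun k hk => ?_, ?_⟩
  · beta_reduce; split_ifs <;> positivity
  · beta_reduce; split_ifs <;> positivity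
  · rw [Finset.sum_add_distrib, ← hσ]; simp
  · rw [Finset.sum_add_distrib, hσ']; simp
  · simp only [if_neg hoz, add_zero]
    exact max_eq_right hκz
  · simp only [if_neg hoz, add_zero]
    exact hQz
  · simp only [if_neg hoz, add_zero]
    refine le_trans ?_ hσle
    rw [← hσ']
    exact Finset.single_le_sum (f := fun j => max (-ν j) 0) (fun j _ => le_max_right _ _)
      (Finset.mem_univ z)
  · simp only [add_sub_add_right_eq_sub, hpm]
    exact hνk k hk
  · simp only [add_mul, Finset.sum_add_distrib, ite_mul, zero_mul]
    simp only [Finset.sum_ite_eq', Finset.mem_univ, if_true, ho, mul_one]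
    have : 0 ≤ σ := Finset.sum_nonneg fun j _ => le_max_right _ _
    linarith

lemma exists_priors {N D : ℕ} (hN : 1 ≤ N) (hD : 1 ≤ D) :
    ∃ (x P Q : Fin (N + 3) → ℝ) (z : Fin (N + 3)),
      x z = 0 ∧ (∀ j ≠ z, 1 ≤ x j) ∧ (∀ j, x j ≤ 1 + (N : ℝ) ^ 2 / (D : ℝ) ^ 2) ∧
      (∀ j, 0 ≤ P j) ∧ (∀ j, 0 ≤ Q j) ∧ ∑ j, P j = 1 ∧ ∑ j, Q j = 1 ∧ P z = 0 ∧
      Real.exp (-(10 * D)) / 100 ≤ Q z ∧ Q z ≤ 1 / 100 ∧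
      (∀ k < N + 2, ∑ j, (P j - Q j) * x j ^ k = 0) ∧ ∑ j, P j * x j ≤ 2 := by
  have hD1 : (1 : ℝ) ≤ D := by exact_mod_cast hD
  have hN1 : (1 : ℝ) ≤ N := by exact_mod_cast hN
  have hD2 : (0 : ℝ) < (D : ℝ) ^ 2 := by positivity
  set x : Fin (N + 3) → ℝ := fun j => node D j / (D : ℝ) ^ 2 with hx
  set w : Fin (N + 3) → ℝ := fun j => nodeWeight D N j with hw
  have hwx : ∀ k < N + 2, ∑ j, w j * x j ^ k = 0 := by
    intro k hk
    have h := sum_nodeWeight_mul_pow hD hk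
    rw [← Fin.sum_univ_eq_sum_range (fun i => nodeWeight D N i * node D i ^ k)] at h
    simp only [hw, hx, div_pow, ← mul_div_assoc, ← Finset.sum_div]
    rw [h, zero_div]
  have hx1 : ∀ j ≠ (0 : Fin (N + 3)), 1 ≤ x j := by
    intro j hj
    rw [hx, one_le_div hD2]
    rcases j with ⟨j, hj'⟩
    match j with
    | 0 => exact absurd rfl hj
    | 1 => simp only [node]; linarith
    | i + 2 => simp only [node]; nlinarith [sq_nonneg (i : ℝ)]
  have hxL : ∀ j, x j ≤ 1 + (N : ℝ) ^ 2 / (D : ℝ) ^ 2 := by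
    rintro ⟨j, hj⟩
    have e : 1 + (N : ℝ) ^ 2 / (D : ℝ) ^ 2 = ((D : ℝ) ^ 2 + (N : ℝ) ^ 2) / (D : ℝ) ^ 2 := by
      field_simp
    rw [e]
    refine div_le_div_of_nonneg_right ?_ hD2.le
    match j with
    | 0 => simp only [node]; positivity
    | 1 => simp only [node]; nlinarith
    | i + 2 =>
      simp only [node]
      have : (i : ℝ) ≤ N := by exact_mod_cast (by omega : i ≤ N)
      gcongr
  have hw0 := abs_nodeWeight_zero_ge hD N
  have hf : (0 : ℝ) < (N.factorial : ℝ) ^ 2 := by positivity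
  have hwz : w 0 ≠ 0 := by
    intro h
    have h' : nodeWeight D N 0 = 0 := h
    rw [h', abs_zero] at hw0
    have : 0 < 1 / (2 * (D : ℝ) ^ 4 * (N.factorial : ℝ) ^ 2 * Real.exp (4 * D)) := by positivity
    linarith
  -- Index 2 is the node `D² + 0²`, which rescales to 1.
  obtain ⟨P, Q, hP, hQ, hP1, hQ1, hPz, hS0, hQz, hQz', hm, hmean⟩ :=
    exists_moment_matching_laws (x := x) (w := w) (J := N + 2) (by omega) hwx (z := 0)
      (o := ⟨2, by omega⟩) (by simp [hx, node]) (by simp [hx, node, hD2.ne'])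
      hx1 hwz
  refine ⟨x, P, Q, 0, by simp [hx, node], hx1, hxL, hP, hQ, hP1, hQ1, hPz, ?_, hQz', hm, hmean⟩
  rw [hQz]
  have hS : ∑ j, |w j| * x j ≤ 24 / (N.factorial : ℝ) ^ 2 / (D : ℝ) ^ 2 := by
    have h := sum_abs_nodeWeight_mul_node_le hD N
    rw [← Fin.sum_univ_eq_sum_range (fun i => |nodeWeight D N i| * node D i)] at h
    simp only [hw, hx, ← mul_div_assoc, ← Finset.sum_div]
    exact div_le_div_of_nonneg_right h hD2.le
  -- The ratio of the two weight bounds is `exp (-4 D) / (48 D²)`; this absorbs the polynomial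
  -- factor.
  have hexp : 48 * (D : ℝ) ^ 2 ≤ Real.exp (6 * D) := by
    have h1 : Real.exp (6 * D) = Real.exp (4 : ℝ) * Real.exp (6 * D - 4) := by
      rw [← Real.exp_add]; ring_nf
    have h2 : (48 : ℝ) ≤ Real.exp 4 := by
      have : Real.exp 4 = Real.exp 1 ^ 4 := by rw [← Real.exp_nat_mul]; norm_num
      rw [this]
      calc (48 : ℝ) ≤ 2.7 ^ 4 := by norm_num
        _ ≤ _ := pow_le_pow_left₀ (by norm_num) (by linarith [Real.exp_one_gt_d9]) 4
    have h3 : (D : ℝ) ^ 2 ≤ Real.exp (6 * D - 4) := by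
      have h4 : Real.exp (6 * D - 4) = Real.exp (3 * D - 2) ^ 2 := by
        rw [← Real.exp_nat_mul]; ring_nf
      rw [h4]
      refine pow_le_pow_left₀ (by positivity) ?_ 2
      linarith [Real.add_one_le_exp (3 * (D : ℝ) - 2)]
    rw [h1]
    exact mul_le_mul h2 h3 (by positivity) (by positivity)
  rw [div_le_div_iff₀ (by norm_num) (by positivity)]
  have h5 : Real.exp (-(10 * D)) * (24 / (N.factorial : ℝ) ^ 2 / (D : ℝ) ^ 2) ≤ |w 0| := by
    refine le_trans ?_ hw0
    have e : Real.exp (-(10 * (D : ℝ))) = 1 / (Real.exp (4 * D) * Real.exp (6 * D)) := by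
      rw [← Real.exp_add, one_div, ← Real.exp_neg]; ring_nf
    rw [e, div_div, div_mul_div_comm, div_le_div_iff₀ (by positivity) (by positivity)]
    have h6 : 0 ≤ (D : ℝ) ^ 2 * (N.factorial : ℝ) ^ 2 * Real.exp (4 * D) := by positivity
    nlinarith [mul_le_mul_of_nonneg_left hexp h6]
  nlinarith [mul_le_mul_of_nonneg_left hS (Real.exp_nonneg (-(10 * (D : ℝ))))]

/-! ### Indistinguishability and the lower bound -/

lemma isFarFromBig_of_zeros {n : ℕ} {T ε : ℝ} {p : Fin n → ℝ} (hp : p ∈ stdSimplex ℝ (Fin n))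
    (h : ε ≤ (#{i | p i = 0} : ℝ) * T) : IsFarFromBig T ε p := by
  refine ⟨hp, fun q hq => h.trans ?_⟩
  have h1 : ∑ i, (q i - p i) = 0 := by rw [Finset.sum_sub_distrib, hq.1.2, hp.2, sub_self]
  -- Distance is the sum of the positive parts of `q - p`, and each zero of `p` contributes at least
  -- `T`.
  have h2 : ∀ i, (if p i = 0 then T else 0) ≤ (1 / 2) * (|p i - q i| + (q i - p i)) := by
    intro i
    split_ifs with hi
    · have := hq.2 i
      rw [hi, zero_sub, abs_neg, sub_zero]
      linarith [le_abs_self (q i)]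
    · rw [abs_sub_comm]
      linarith [neg_abs_le (q i - p i)]
  have h3 := Finset.sum_le_sum fun i (_ : i ∈ Finset.univ) => h2 i
  rw [← Finset.mul_sum, Finset.sum_add_distrib, h1, add_zero, ← Finset.sum_filter,
    Finset.sum_const, nsmul_eq_mul] at h3
  exact h3

lemma poissonized_nonneg {n m : ℕ} {a : (Fin m → Fin n) → ℝ} (ha : ∀ x, 0 ≤ a x) (R : ℕ)
    {u : Fin n → ℝ} (hu : ∀ i, 0 ≤ u i) : 0 ≤ poissonized a R u := by
  have hs : 0 ≤ ∑ i, u i := Finset.sum_nonneg fun i _ => hu i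
  refine mul_nonneg (Real.exp_nonneg _) (Finset.sum_nonneg fun M _ => ?_)
  refine mul_nonneg (by positivity) (Finset.sum_nonneg fun x _ => ?_)
  exact mul_nonneg (Finset.prod_nonneg fun j _ => hu _) (ha x)

lemma div_sum_mem_stdSimplex {n : ℕ} {u : Fin n → ℝ} (hu : ∀ i, 0 ≤ u i) (hs : 0 < ∑ i, u i) :
    (fun i => u i / ∑ i, u i) ∈ stdSimplex ℝ (Fin n) :=
  ⟨fun i => div_nonneg (hu i) hs.le, by rw [← Finset.sum_div, div_self hs.ne']⟩

/-- The intensity cap `J / 20` is small enough: `J ^ J / J! ≤ exp J` reduces the claim to `exp (41 /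
20) ≤ 10`. -/
lemma poissonMix_error_le (J : ℕ) :
    (2 * ((J : ℝ) / 20)) ^ J / (J.factorial : ℝ) * Real.exp ((J : ℝ) / 20) ≤
      Real.exp (-(J : ℝ)) := by
  have h1 : (2 * ((J : ℝ) / 20)) ^ J / (J.factorial : ℝ) ≤ (1 / 10) ^ J * Real.exp J := by
    have e : (2 * ((J : ℝ) / 20)) ^ J = (1 / 10) ^ J * (J : ℝ) ^ J := by
      rw [← mul_pow]; congr 1; ring
    rw [e, mul_div_assoc]
    exact mul_le_mul_of_nonneg_left (Real.pow_div_factorial_le_exp _ (Nat.cast_nonneg J) J)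
      (by positivity)
  have h2 : Real.exp (41 / 20) ≤ 10 := by
    refine (pow_le_pow_iff_left₀ (Real.exp_nonneg _) (by norm_num) (n := 20) (by norm_num)).mp ?_
    have : Real.exp (41 / 20) ^ 20 = Real.exp 1 ^ 41 := by
      rw [← Real.exp_nat_mul, ← Real.exp_nat_mul]; norm_num
    rw [this]
    calc Real.exp 1 ^ 41 ≤ 2.72 ^ 41 :=
          pow_le_pow_left₀ (Real.exp_nonneg _) (by linarith [Real.exp_one_lt_d9]) 41
      _ ≤ _ := by norm_num
  have h3 : Real.exp (41 / 20 * J) ≤ 10 ^ J := by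
    rw [mul_comm, Real.exp_nat_mul]
    exact pow_le_pow_left₀ (Real.exp_nonneg _) h2 J
  calc _ ≤ (1 / 10) ^ J * Real.exp J * Real.exp ((J : ℝ) / 20) :=
        mul_le_mul_of_nonneg_right h1 (Real.exp_nonneg _)
    _ = (1 / 10) ^ J * Real.exp (41 / 20 * J) * Real.exp (-(J : ℝ)) := by
        rw [mul_assoc, mul_assoc, ← Real.exp_add, ← Real.exp_add]
        congr 2
        ring
    _ ≤ (1 / 10) ^ J * 10 ^ J * Real.exp (-(J : ℝ)) := by gcongr
    _ = Real.exp (-(J : ℝ)) := by rw [← mul_pow]; norm_num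

lemma abs_iidExp_poissonized_sub_le {ι : Type*} [Fintype ι] {n m J : ℕ} {P Q y : ι → ℝ}
    (hP : ∀ j, 0 ≤ P j) (hQ : ∀ j, 0 ≤ Q j) (hP1 : ∑ j, P j = 1) (hQ1 : ∑ j, Q j = 1)
    (hy : ∀ j, 0 ≤ y j ∧ y j ≤ (J : ℝ) / 20) (hPQ : ∀ k < J, ∑ j, (P j - Q j) * y j ^ k = 0)
    {a : (Fin m → Fin n) → ℝ} (ha : ∀ x, 0 ≤ a x ∧ a x ≤ 1) (R : ℕ) :
    |iidExp P (fun v => poissonized a R fun i => y (v i)) -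
      iidExp Q (fun v => poissonized a R fun i => y (v i))| ≤ n * (4 * Real.exp (-(J : ℝ))) := by
  refine abs_iidExp_sub_le hP hP1 hQ hQ1 fun i v => ?_
  obtain ⟨g, hg, hgt⟩ := poissonized_update ha R (u := fun l => y (v l)) (fun l => (hy _).1) i
  have e : ∀ j, poissonized a R (fun l => y (Function.update v i j l)) =
      ∑ k ∈ range R, g k * (Real.exp (-y j) * y j ^ k / (k.factorial : ℝ)) := by
    intro j
    rw [← hgt]
    congr 1
    funext l
    by_cases hl : l = i
    · subst hl; simp
    · simp [hl]
  simp only [e]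
  refine (abs_sum_poissonMix_le hy hPQ hg R).trans ?_
  have h2 : ∑ j, |P j - Q j| ≤ 2 := by
    calc _ ≤ ∑ j, (P j + Q j) := Finset.sum_le_sum fun j _ => by
          rw [abs_le]; constructor <;> linarith [hP j, hQ j]
      _ = 2 := by rw [Finset.sum_add_distrib, hP1, hQ1]; norm_num
  calc _ ≤ 2 * (2 * Real.exp (-(J : ℝ))) :=
        mul_le_mul h2 (mul_le_mul_of_nonneg_left (poissonMix_error_le J) (by norm_num))
          (by positivity) (by norm_num)
    _ = _ := by ring

/-- No tester with few samples: the quantitative form with free parameters. -/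
lemma not_isTester {n m N D : ℕ} (A : Algorithm n m) {ε lam : ℝ} (hN : 1 ≤ N) (hD : 1 ≤ D)
    (hlam : lam * (1 + (N : ℝ) ^ 2 / (D : ℝ) ^ 2) = ((N + 2 : ℕ) : ℝ) / 20)
    (hm : 8 * (m : ℝ) ≤ lam * n) (hn : 40 ≤ lam * n)
    (hε : ε ≤ Real.exp (-(10 * D)) / 16000) (hδ : 2000 ≤ n * Real.exp (-(10 * D)))
    (hJ : 400 * (n : ℝ) ≤ Real.exp ((N + 2 : ℕ) : ℝ)) :
    ¬ IsTester A (1 / (40 * (n : ℝ))) ε := by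
  rintro ⟨hacc, hrej⟩
  obtain ⟨x, P, Q, z, hxz, hx1, hxL, hP, hQ, hP1, hQ1, hPz, hQz, hQz', hPQ, hmean⟩ :=
    exists_priors hN hD
  have hL : 0 < 1 + (N : ℝ) ^ 2 / (D : ℝ) ^ 2 := by positivity
  have hlam0 : 0 < lam := by
    by_contra hc
    have : lam * n ≤ 0 := mul_nonpos_of_nonpos_of_nonneg (not_lt.mp hc) (Nat.cast_nonneg n)
    linarith
  have hn0 : (0 : ℝ) < n := by
    by_contra hc
    have : lam * n ≤ 0 := mul_nonpos_of_nonneg_of_nonpos hlam0.le (not_lt.mp hc)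
    linarith
  have hx0 : ∀ j, 0 ≤ x j := fun j => by
    by_cases h : j = z
    · rw [h, hxz]
    · linarith [hx1 j h]
  set y : Fin (N + 3) → ℝ := fun j => lam * x j with hy
  have hy0 : ∀ j, 0 ≤ y j := fun j => mul_nonneg hlam0.le (hx0 j)
  have hsum : ∀ v : Fin n → Fin (N + 3), ∑ i, y (v i) = lam * ∑ i, x (v i) := fun v => by
    simp only [hy, Finset.mul_sum]
  -- There are finitely many `v`, so one cutoff serves them all. A total `∑ x ≥ n / 2` gives
  -- intensity at least 20 and at least `4 m`.
  obtain ⟨R, hR⟩ : ∃ R : ℕ, ∀ v : Fin n → Fin (N + 3), (n : ℝ) / 2 ≤ ∑ i, x (v i) →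
      (98 / 100 : ℝ) ≤ Real.exp (-∑ i, y (v i)) *
        ∑ M ∈ Ico m R, (∑ i, y (v i)) ^ M / (M.factorial : ℝ) := by
    refine Filter.Eventually.exists (f := Filter.atTop) (Filter.eventually_all.mpr fun v => ?_)
    by_cases hv : (n : ℝ) / 2 ≤ ∑ i, x (v i)
    · have h1 := mul_le_mul_of_nonneg_left hv hlam0.le
      rw [← hsum] at h1
      filter_upwards [eventually_poisson_Ico_ge (s := ∑ i, y (v i)) (m := m) (by linarith)
        (by linarith)] with R hR _ using hR
    · exact Filter.Eventually.of_forall fun R h => absurd h hv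
  have key : ∀ (b : Bool) (v : Fin n → Fin (N + 3)), (n : ℝ) / 2 ≤ ∑ i, x (v i) →
      2 / 3 ≤ outputProb A (fun i => y (v i) / ∑ i, y (v i)) b →
      (2 / 3 * (98 / 100) : ℝ) ≤ poissonized (fun w => (A w b).toReal) R fun i => y (v i) := by
    intro b v hv hb
    have hs : 0 < ∑ i, y (v i) := by
      rw [hsum]
      exact mul_pos hlam0 (by linarith)
    rw [poissonized_eq_outputProb A b R hs]
    exact mul_le_mul hb (hR v hv) (by norm_num) (by linarith)
  have hdiv : ∀ (v : Fin n → Fin (N + 3)) i,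
      y (v i) / ∑ i, y (v i) = x (v i) / ∑ i, x (v i) := fun v i => by
    rw [hsum]
    exact mul_div_mul_left _ _ hlam0.ne'
  have hnn : ∀ (b : Bool) (v : Fin n → Fin (N + 3)),
      0 ≤ poissonized (fun w => (A w b).toReal) R fun i => y (v i) := fun b v =>
    poissonized_nonneg (fun w => (toReal_apply_mem _ _).1) R fun i => hy0 _
  have hPacc : (62 / 100 : ℝ) ≤
      iidExp P fun v => poissonized (fun w => (A w true).toReal) R fun i => y (v i) := by
    have h1 := iidExp_markov (n := n) hP hP1 hx0 (B := 40 * n) (by positivity)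
    have h2 : (n : ℝ) * (∑ j, P j * x j) / (40 * n) ≤ 1 / 20 := by
      rw [div_le_div_iff₀ (by positivity) (by norm_num)]
      nlinarith
    -- Outside the Markov event the normalised vector is big, so the tester accepts: the total is at
    -- least `0.6533 * (1 - 1/20)`.
    have h3 : iidExp P (fun v : Fin n → Fin (N + 3) => 2 / 3 * (98 / 100) * (1 + (-1) *
        if 40 * (n : ℝ) < ∑ i, x (v i) then (1 : ℝ) else 0)) ≤
        iidExp P fun v => poissonized (fun w => (A w true).toReal) R fun i => y (v i) := by
      refine iidExp_mono hP fun v hv => ?_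
      split_ifs with h
      · norm_num
        exact hnn true v
      · have hvz : ∀ i, 1 ≤ x (v i) := fun i => hx1 _ fun hi => hv i (by rw [hi, hPz])
        have hge : (n : ℝ) ≤ ∑ i, x (v i) := by
          have := Finset.sum_le_sum fun i (_ : i ∈ Finset.univ) => hvz i
          simpa using this
        have hpos : 0 < ∑ i, x (v i) := by linarith
        rw [mul_zero, add_zero, mul_one]
        refine key true v (by linarith) (hacc _ ?_)
        simp only [hdiv]
        refine ⟨div_sum_mem_stdSimplex (fun i => hx0 (v i)) hpos, fun i => ?_⟩
        exact div_le_div₀ (by linarith [hvz i]) (hvz i) hpos (not_lt.mp h)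
    rw [iidExp_const_mul, iidExp_add, iidExp_const_mul, iidExp_one P hP1] at h3
    linarith
  have hQrej : (63 / 100 : ℝ) ≤
      iidExp Q fun v => poissonized (fun w => (A w false).toReal) R fun i => y (v i) := by
    have h1 := iidExp_markov (n := n) hQ hQ1 (f := fun j => if j = z then (1 : ℝ) else 0)
      (fun j => by split_ifs <;> norm_num) (B := n / 2) (by positivity)
    have h2 : (n : ℝ) * (∑ j, Q j * if j = z then (1 : ℝ) else 0) / (n / 2) ≤ 1 / 50 := by
      simp only [mul_ite, mul_one, mul_zero, Finset.sum_ite_eq', Finset.mem_univ, if_true]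
      rw [div_le_div_iff₀ (by positivity) (by norm_num)]
      nlinarith
    have h4 := iidExp_few_le (n := n) hQ hQ1 z
    have h5 : Real.exp (-(n * Q z / 4)) ≤ 1 / 100 := by
      have h6 : (5 : ℝ) ≤ n * Q z / 4 := by nlinarith
      have h7 : (100 : ℝ) ≤ Real.exp (n * Q z / 4) := by
        refine le_trans ?_ (Real.exp_le_exp.mpr h6)
        have : Real.exp 5 = Real.exp 1 ^ 5 := by rw [← Real.exp_nat_mul]; norm_num
        rw [this]
        calc (100 : ℝ) ≤ 2.7 ^ 5 := by norm_num
          _ ≤ _ := pow_le_pow_left₀ (by norm_num) (by linarith [Real.exp_one_gt_d9]) 5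
      rw [Real.exp_neg, one_div]
      exact inv_anti₀ (by norm_num) h7
    -- Two bad events are removed: more than half of the entries zero (the total might be too small)
    -- and too few zeros (the vector might not be far). They cost `1/50` and `1/100`.
    have h3 : iidExp Q (fun v : Fin n → Fin (N + 3) => 2 / 3 * (98 / 100) * ((1 + (-1) *
        if (n : ℝ) / 2 < ∑ i, (if v i = z then (1 : ℝ) else 0) then (1 : ℝ) else 0) + (-1) *
        if (#{i | v i = z} : ℝ) < n * Q z / 4 then (1 : ℝ) else 0)) ≤
        iidExp Q fun v => poissonized (fun w => (A w false).toReal) R fun i => y (v i) := by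
      refine iidExp_mono hQ fun v hv => ?_
      have hnn' := hnn false v
      split_ifs with h h' h'
      · linarith
      · linarith
      · linarith
      · have hge : (n : ℝ) / 2 ≤ ∑ i, x (v i) := by
          have h8 : ∑ i, (1 - if v i = z then (1 : ℝ) else 0) ≤ ∑ i, x (v i) := by
            refine Finset.sum_le_sum fun i _ => ?_
            split_ifs with hi
            · simpa using hx0 (v i)
            · simpa using hx1 _ hi
          rw [Finset.sum_sub_distrib] at h8
          simp only [Finset.sum_const, Finset.card_univ, Fintype.card_fin, nsmul_eq_mul,
            mul_one] at h8
          linarith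
        have hpos : 0 < ∑ i, x (v i) := by linarith
        rw [mul_zero, add_zero, add_zero, mul_one]
        refine key false v hge (hrej _ ?_)
        simp only [hdiv]
        refine isFarFromBig_of_zeros (div_sum_mem_stdSimplex (fun i => hx0 (v i)) hpos) ?_
        have hc : (#{i | v i = z} : ℝ) ≤ (#{i | x (v i) / ∑ i, x (v i) = 0} : ℝ) := by
          refine Nat.cast_le.mpr (Finset.card_le_card fun i hi => ?_)
          simp only [Finset.mem_filter, Finset.mem_univ, true_and] at hi ⊢
          rw [hi, hxz, zero_div]
        calc ε ≤ (n * Q z / 4) * (1 / (40 * n)) := by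
              have e : (n * Q z / 4) * (1 / (40 * n)) = Q z / 160 := by field_simp; ring
              rw [e]
              linarith
          _ ≤ _ := mul_le_mul_of_nonneg_right ((not_lt.mp h').trans hc) (by positivity)
    rw [iidExp_const_mul, iidExp_add, iidExp_add, iidExp_const_mul, iidExp_const_mul,
      iidExp_one Q hQ1] at h3
    linarith
  have hdiff := abs_iidExp_poissonized_sub_le (J := N + 2) (y := y) hP hQ hP1 hQ1
    (fun j => ⟨hy0 j, by rw [← hlam]; exact mul_le_mul_of_nonneg_left (hxL j) hlam0.le⟩)
    (fun k hk => by
      have : ∀ j, (P j - Q j) * y j ^ k = lam ^ k * ((P j - Q j) * x j ^ k) := fun j => by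
        rw [hy, mul_pow]; ring
      rw [Finset.sum_congr rfl fun j _ => this j, ← Finset.mul_sum, hPQ k hk, mul_zero])
    (a := fun w => (A w true).toReal) (fun w => toReal_apply_mem _ _) R
  have herr : (n : ℝ) * (4 * Real.exp (-((N + 2 : ℕ) : ℝ))) ≤ 1 / 100 := by
    have h1 := mul_le_mul_of_nonneg_right hJ (Real.exp_nonneg (-((N + 2 : ℕ) : ℝ)))
    rw [← Real.exp_add, add_neg_cancel, Real.exp_zero] at h1
    linarith
  -- Accepting and rejecting weights under `Q` sum to at most 1, but `0.62 + 0.63` exceeds 1 by more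
  -- than the exchange error `0.01`.
  have hone : iidExp Q (fun v => poissonized (fun w => (A w true).toReal) R fun i => y (v i)) +
      iidExp Q (fun v => poissonized (fun w => (A w false).toReal) R fun i => y (v i)) ≤ 1 := by
    rw [← iidExp_add]
    refine le_trans (iidExp_mono hQ fun v _ => ?_) (iidExp_one (n := n) Q hQ1).le
    exact poissonized_true_add_false_le A R fun i => hy0 _
  have := (abs_le.mp (hdiff.trans herr)).2
  linarith

/-! ### Choice of parameters -/

lemma tester_samples_ge {a : ℝ} (ha : 0 < a) {n m : ℕ} (hna : 1 / a ≤ n)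
    (hn : Real.exp 40 ≤ n) {ε : ℝ} (hε : a / n ≤ ε) (hε' : ε ≤ Real.exp (-40))
    (A : Algorithm n m) (hA : IsTester A (1 / (40 * (n : ℝ))) ε) :
    1 / 10 ^ 7 * ((n : ℝ) * Real.log (1 / ε) ^ 2 / Real.log (n : ℝ)) ≤ (m : ℝ) := by
  have hn0 : (0 : ℝ) < n := (Real.exp_pos _).trans_le hn
  have hε0 : 0 < ε := (div_pos ha hn0).trans_le hε
  set t := Real.log n with ht
  have hnt : (n : ℝ) = Real.exp t := (Real.exp_log hn0).symm
  have ht40 : 40 ≤ t := by rwa [ht, Real.le_log_iff_exp_le hn0]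
  set g := Real.log (1 / ε) with hg
  have hεg : ε = Real.exp (-g) := by
    rw [hg, one_div, Real.log_inv, neg_neg, Real.exp_log hε0]
  have hg40 : 40 ≤ g := by
    rw [hεg, Real.exp_le_exp] at hε'
    linarith
  -- For `n ≥ 1 / a` the condition `a / n ≤ ε` gives `1 / ε ≤ n²`.
  have hg2 : g ≤ 2 * t := by
    have h1 : 1 / ε ≤ (n : ℝ) * n := by
      rw [div_le_iff₀ hε0]
      rw [div_le_iff₀ hn0] at hε
      rw [div_le_iff₀ ha] at hna
      nlinarith
    have h2 := Real.log_le_log (by positivity) h1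
    rw [Real.log_mul hn0.ne' hn0.ne'] at h2
    linarith
  -- Capping at `log n` ensures that the expected number of zeros, of order `n * exp (-10 D)`, is
  -- large; it loses at most a factor 2 in `log (1/ε)`.
  set l := min g t with hl
  have hl40 : 40 ≤ l := le_min hg40 ht40
  have hlg : g ≤ 2 * l := by
    rcases min_choice g t with h | h <;> rw [← hl] at h <;> rw [h] <;> linarith
  have hlt : l ≤ t := min_le_right _ _
  -- Then `10 D ≤ l / 2`, and the spare `l / 2 ≥ 20` in the exponent pays for the constants 16000
  -- and 2000.
  set D := ⌊l / 20⌋₊ with hD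
  have hD1 : (D : ℝ) ≤ l / 20 := Nat.floor_le (by linarith)
  have hD2 : l / 40 ≤ D := by
    have := Nat.lt_floor_add_one (l / 20)
    rw [← hD] at this
    linarith
  have hD0 : (1 : ℝ) ≤ D := by linarith
  -- This makes `exp (N + 2) ≥ n²`, which beats `400 n`.
  set N := ⌈2 * t⌉₊ with hN
  have hN1 : 2 * t ≤ N := Nat.le_ceil _
  have hN2 : (N : ℝ) ≤ 3 * t := by
    have := Nat.ceil_lt_add_one (show 0 ≤ 2 * t by linarith)
    rw [← hN] at this
    linarith
  have hL : 0 < 1 + (N : ℝ) ^ 2 / (D : ℝ) ^ 2 := by positivity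
  set lam := ((N + 2 : ℕ) : ℝ) / 20 / (1 + (N : ℝ) ^ 2 / (D : ℝ) ^ 2) with hlam
  have hN0 : (0 : ℝ) < N := by linarith
  have hlam_ge : (D : ℝ) ^ 2 / (40 * N) ≤ lam := by
    have h1 : 1 + (N : ℝ) ^ 2 / (D : ℝ) ^ 2 ≤ 2 * ((N : ℝ) ^ 2 / (D : ℝ) ^ 2) := by
      have : 1 ≤ (N : ℝ) ^ 2 / (D : ℝ) ^ 2 := by
        rw [one_le_div (by positivity)]
        exact pow_le_pow_left₀ (by linarith) (by linarith) 2
      linarith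
    calc (D : ℝ) ^ 2 / (40 * N) = (N : ℝ) / 20 / (2 * ((N : ℝ) ^ 2 / (D : ℝ) ^ 2)) := by
          field_simp
          norm_num
      _ ≤ lam := by
          rw [hlam]
          refine div_le_div₀ (by positivity) ?_ hL h1
          push_cast
          linarith
  have hlamn : (n : ℝ) * l ^ 2 / (192000 * t) ≤ lam * n := by
    have h1 : l ^ 2 / (192000 * t) ≤ (D : ℝ) ^ 2 / (40 * N) := by
      calc l ^ 2 / (192000 * t) = (l / 40) ^ 2 / (40 * (3 * t)) := by
            field_simp
            norm_num
        _ ≤ _ := by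
            have : 0 ≤ l / 40 := by linarith
            gcongr
    rw [mul_div_assoc, mul_comm]
    exact mul_le_mul_of_nonneg_right (h1.trans hlam_ge) hn0.le
  by_contra! hm
  refine not_isTester (N := N) (D := D) (lam := lam) A ?_ ?_ (div_mul_cancel₀ _ hL.ne') ?_ ?_ ?_
    ?_ ?_ hA
  · exact_mod_cast (by linarith : (1 : ℝ) ≤ N)
  · exact_mod_cast hD0
  · refine le_trans ?_ hlamn
    -- From `g ≤ 2 l` comes a factor 4, and `8 * 4 / 10 ^ 7 ≤ 1 / 192000` fixes the constant `1 / 10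
    -- ^ 7`.
    have h1 : (n : ℝ) * g ^ 2 / t ≤ 4 * ((n : ℝ) * l ^ 2 / t) := by
      have : (n : ℝ) * g ^ 2 ≤ n * (2 * l) ^ 2 := by
        have : 0 ≤ g := by linarith
        gcongr
      calc _ ≤ (n : ℝ) * (2 * l) ^ 2 / t := by gcongr
        _ = _ := by ring
    have h2 : (n : ℝ) * l ^ 2 / (192000 * t) = 1 / 192000 * ((n : ℝ) * l ^ 2 / t) := by
      field_simp
    have h3 : 0 ≤ (n : ℝ) * l ^ 2 / t := by positivity
    rw [h2]
    linarith
  · refine le_trans ?_ hlamn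
    rw [le_div_iff₀ (by positivity), hnt]
    have h1 := Real.pow_div_factorial_le_exp t (by linarith) 5
    have h2 : (t : ℝ) ^ 5 / (Nat.factorial 5 : ℝ) = t * t ^ 4 / 120 := by
      norm_num [Nat.factorial]; ring
    rw [h2] at h1
    have h3 : (40 : ℝ) ^ 4 ≤ t ^ 4 := pow_le_pow_left₀ (by norm_num) ht40 4
    have h4 : (40 : ℝ) ^ 2 ≤ l ^ 2 := pow_le_pow_left₀ (by norm_num) hl40 2
    have h5 := mul_le_mul_of_nonneg_left h3 (show 0 ≤ t by linarith)
    have h6 := mul_le_mul_of_nonneg_left h4 (Real.exp_nonneg t)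
    nlinarith
  · have h1 : ε ≤ Real.exp (-l) := by
      rw [hεg]
      exact Real.exp_le_exp.mpr (neg_le_neg (min_le_left _ _))
    have h2 : Real.exp (-l) * Real.exp 20 ≤ Real.exp (-(10 * D)) := by
      rw [← Real.exp_add]
      exact Real.exp_le_exp.mpr (by linarith)
    have h3 : (16000 : ℝ) ≤ Real.exp 20 := by
      have : Real.exp 20 = Real.exp 1 ^ 20 := by rw [← Real.exp_nat_mul]; norm_num
      rw [this]
      calc (16000 : ℝ) ≤ 2 ^ 20 := by norm_num
        _ ≤ _ := pow_le_pow_left₀ (by norm_num) (by linarith [Real.exp_one_gt_d9]) 20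
    rw [le_div_iff₀ (by norm_num)]
    nlinarith [Real.exp_pos (-l)]
  · rw [hnt, ← Real.exp_add]
    have h2 : Real.exp 20 ≤ Real.exp (t + -(10 * D)) := Real.exp_le_exp.mpr (by linarith)
    refine le_trans ?_ h2
    have : Real.exp 20 = Real.exp 1 ^ 20 := by rw [← Real.exp_nat_mul]; norm_num
    rw [this]
    calc (2000 : ℝ) ≤ 2 ^ 20 := by norm_num
      _ ≤ _ := pow_le_pow_left₀ (by norm_num) (by linarith [Real.exp_one_gt_d9]) 20
  · have h1 : Real.exp t * Real.exp t ≤ Real.exp ((N + 2 : ℕ) : ℝ) := by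
      rw [← Real.exp_add]
      refine Real.exp_le_exp.mpr ?_
      push_cast
      linarith
    refine le_trans ?_ h1
    rw [hnt]
    have h2 : (400 : ℝ) ≤ Real.exp t := by
      refine le_trans ?_ (Real.exp_le_exp.mpr ht40)
      have : Real.exp 40 = Real.exp 1 ^ 40 := by rw [← Real.exp_nat_mul]; norm_num
      rw [this]
      calc (400 : ℝ) ≤ 2 ^ 40 := by norm_num
        _ ≤ _ := pow_le_pow_left₀ (by norm_num) (by linarith [Real.exp_one_gt_d9]) 40
    exact mul_le_mul_of_nonneg_right h2 (Real.exp_nonneg t)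

end Bigness

theorem mainTheorem2 :
    ∃ ε₀ : ℝ, 0 < ε₀ ∧ ∃ c : ℝ, 0 < c ∧ ∃ β : ℝ → ℝ, (∀ ε : ℝ, 0 < ε → ε ≤ ε₀ → 0 < β ε) ∧
      (∀ a : ℝ, 0 < a → ∃ n₀ : ℕ, ∀ n : ℕ, n₀ ≤ n → ∀ ε : ℝ, a / (n : ℝ) ≤ ε → ε ≤ ε₀ →
        ∀ (m : ℕ) (A : Bigness.Algorithm n m),
          Bigness.IsTester A (1 / (β ε * (n : ℝ))) ε →
            c * ((n : ℝ) * Real.log (1 / ε) ^ 2 / Real.log (n : ℝ)) ≤ (m : ℝ)) ∧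
      (∀ ε : ℝ, 0 < ε → ε ≤ ε₀ → ∃ c' : ℝ, 0 < c' ∧ ∃ n₁ : ℕ, ∀ n : ℕ, n₁ ≤ n →
        ∀ (m : ℕ) (A : Bigness.Algorithm n m),
          Bigness.IsTester A (1 / (β ε * (n : ℝ))) ε →
            c' * ((n : ℝ) / Real.log (n : ℝ)) ≤ (m : ℝ)) := by
  refine ⟨Real.exp (-40), Real.exp_pos _, 1 / 10 ^ 7, by norm_num, fun _ => 40,
    fun _ _ _ => by norm_num, fun a ha => ?_, fun ε hε hε' => ?_⟩
  · refine ⟨max ⌈1 / a⌉₊ ⌈Real.exp 40⌉₊, fun n hn ε h1 h2 m A hA => ?_⟩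
    exact Bigness.tester_samples_ge ha (Nat.ceil_le.mp ((le_max_left _ _).trans hn))
      (Nat.ceil_le.mp ((le_max_right _ _).trans hn)) h1 h2 A hA
  · have hlog : 0 < Real.log (1 / ε) := by
      rw [one_div, Real.log_inv]
      have := Real.log_le_log hε hε'
      rw [Real.log_exp] at this
      linarith
    -- For fixed `ε` the factor `log² (1/ε)` is a constant, and the case `a = 1` of the general
    -- bound applies once `n ≥ 1 / ε`.
    refine ⟨1 / 10 ^ 7 * Real.log (1 / ε) ^ 2, by positivity,
      max ⌈1 / ε⌉₊ ⌈Real.exp 40⌉₊, fun n hn m A hA => ?_⟩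
    have h1 : 1 / ε ≤ n := Nat.ceil_le.mp ((le_max_left _ _).trans hn)
    have h2 : Real.exp 40 ≤ n := Nat.ceil_le.mp ((le_max_right _ _).trans hn)
    have hn0 : (0 : ℝ) < n := (Real.exp_pos _).trans_le h2
    have h3 := Bigness.tester_samples_ge (a := 1) one_pos
      (by linarith [Real.add_one_le_exp (40 : ℝ)]) h2
      (by rwa [div_le_iff₀ hn0, mul_comm, ← div_le_iff₀ hε]) hε' A hA
    refine le_trans (le_of_eq ?_) h3
    ring
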